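/- Let $\mathbb K$ be an algebraically closed field of characteristic zero and let $G=\mathrm{SL}_2\times T'$, where $T'$ is an algebraic torus over $\mathbb K$ (up to a finite covering, this is the general connected reductive group of semisimple rank one). Fix a maximal torus $T$ of $G$, a Borel subgroup $B\supset T$ of $G$, and let $U$ be the unipotent radical of $B$. Let $X$ be a normal irreducible affine variety with a regular action of $G$ such that $T$ has an open orbit in $X$ (so $X$ is a toric $T$-variety and in particular a spherical $G$-variety). A $\mathbb G_a$-subgroup of $\mathrm{Aut}(X)$ is the image of a non-trivial regular action of $\mathbb G_a=(\mathbb K,+)$ on $X$. A $B$-root subgroup on $X$ is a $\mathbb G_a$-subgroup of $\mathrm{Aut}(X)$ normalized by $B$; it is called vertical if it acts trivially on $\mathbb K[X]^U$, and horizontal otherwise. Two subgroups $H_1,H_2\subset\mathrm{Aut}(X)$ are equivalent if there is a non-empty open subset $W\subseteq X$ such that $H_1x\cap W=H_2x\cap W$ for all $x\in W$. A $B$-root subgroup $H$ moves a $B$-stable prime divisor $D\subset X$ if $D$ is not $H$-stable. **Theorem.** There is a bijection between the equivalence classes of horizontal $B$-root subgroups on $X$ and the $G$-stable prime divisors on $X$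 such that, for every $G$-stable prime divisor $D\subset X$, the equivalence class corresponding to $D$ consists of exactly all $B$-root subgroups on $X$ that move $D$. -/

import Mathlib

open scoped MatrixGroups

noncomputable section

namespace AffineVar

/-! ### Affine varieties and their automorphisms

An affine variety `X` over an algebraically closed field `K` is given by its coordinate algebra
`A = K[X]`; its points are the `K`-algebra homomorphisms `A → K` (evaluations), with the Zariski
topology. -/

/-- The set of (closed) points of the affine variety with coordinate algebra `A`. -/
def Pt (K A : Type*) [Field K] [CommRing A] [Algebra K A] : Type _ := A →ₐ[K] K

section Basics

variable {K A : Type*} [Field K] [CommRing A] [Algebra K A]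

/-- The value `f(x)` of a regular function `f` at a point `x`. -/
def Pt.eval (x : Pt K A) : A →ₐ[K] K := x

/-- The Zariski topology: the topology induced by sending a point to its maximal ideal. -/
instance : TopologicalSpace (Pt K A) :=
  TopologicalSpace.induced
    (fun x : Pt K A => (⟨RingHom.ker x.eval, RingHom.ker_isPrime x.eval⟩ : PrimeSpectrum A))
    inferInstance

/-- `Aut(X)` is the group of `K`-algebra automorphisms of `K[X]`. The automorphism `φ` of `X`
acts on points so that `(φ f)(x) = f(φ⁻¹ x)` for regular functions `f`. -/
instance : MulAction (A ≃ₐ[K] A) (Pt K A) where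
  smul φ x := x.eval.comp (φ⁻¹ : A ≃ₐ[K] A).toAlgHom
  one_smul _ := rfl
  mul_smul φ ψ x := by
    change x.eval.comp _ = (x.eval.comp _).comp _
    rw [mul_inv_rev]
    rfl

/-- `(φ x)(f) = x(φ⁻¹ f)`, i.e. `f(φ x) = (φ⁻¹ f)(x)`. -/
theorem eval_smul (φ : A ≃ₐ[K] A) (x : Pt K A) (f : A) : (φ • x).eval f = x.eval (φ⁻¹ f) := rfl

/-- The orbit `H x` of a point under a subgroup of `Aut(X)`. -/
def orbit (H : Subgroup (A ≃ₐ[K] A)) (x : Pt K A) : Set (Pt K A) := {y | ∃ h ∈ H, h • x = y}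

/-- A set of points is stable under a subgroup of `Aut(X)`. -/
def IsStable (H : Subgroup (A ≃ₐ[K] A)) (D : Set (Pt K A)) : Prop :=
  ∀ h ∈ H, ∀ x ∈ D, h • x ∈ D

/-- Equivalence of subgroups of `Aut(X)`: there is a non-empty open `W ⊆ X` such that
`H₁ x ∩ W = H₂ x ∩ W` for all `x ∈ W`. -/
def Equivalent (H₁ H₂ : Subgroup (A ≃ₐ[K] A)) : Prop :=
  ∃ W : Set (Pt K A), IsOpen W ∧ W.Nonempty ∧ ∀ x ∈ W, orbit H₁ x ∩ W = orbit H₂ x ∩ W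

/-- `H` is a `𝔾ₐ`-subgroup of `Aut(X)`: the image of a non-trivial regular action of
`𝔾ₐ = (K, +)` on `X`. Regularity says that for each `f ∈ K[X]` the function `s ↦ s · f` is given
by a polynomial in `s` with coefficients in `K[X]`. -/
def IsGaSubgroup (H : Subgroup (A ≃ₐ[K] A)) : Prop :=
  ∃ σ : Multiplicative K →* (A ≃ₐ[K] A),
    (∀ f : A, ∃ p : Polynomial A, ∀ s : K,
      σ (Multiplicative.ofAdd s) f = p.eval (algebraMap K A s)) ∧
    σ ≠ 1 ∧ H = σ.range

theorem exists_basic_subset {W : Set (Pt K A)} (hW : IsOpen W) (hne : W.Nonempty) :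
    ∃ f : A, f ≠ 0 ∧ ∀ x : Pt K A, x.eval f ≠ 0 → x ∈ W := by
  obtain ⟨V, hV, rfl⟩ := isOpen_induced_iff.1 hW
  obtain ⟨x, hx⟩ := hne
  obtain ⟨_, ⟨f, rfl⟩, hxf, hfV⟩ :=
    PrimeSpectrum.isTopologicalBasis_basic_opens.exists_subset_of_mem_open hx hV
  refine ⟨f, ?_, fun y hy => hfV hy⟩
  rintro rfl
  exact hxf (Submodule.zero_mem _)

end Basics

/-- A prime divisor on `X`: an irreducible closed subset of codimension one. -/
abbrev PrimeDivisor (K A : Type*) [Field K] [CommRing A] [Algebra K A] : Type _ :=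
  {D : TopologicalSpace.IrreducibleCloseds (Pt K A) // Order.coheight D = 1}

/-! ### Irreducibility of `X`, needed for equivalence of subgroups to be transitive -/

section Irreducible

variable {K A : Type*} [Field K] [IsAlgClosed K] [CommRing A] [IsDomain A] [Algebra K A]
  [Algebra.FiniteType K A]

theorem exists_eval_ne_zero {f : A} (hf : f ≠ 0) : ∃ x : Pt K A, x.eval f ≠ 0 := by
  let L := Localization.Away f
  have : IsDomain L :=
    IsLocalization.isDomain_localization (powers_le_nonZeroDivisors_of_noZeroDivisors hf)
  have : Algebra.FiniteType A L := inferInstance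
  have : Algebra.FiniteType K L := Algebra.FiniteType.trans (S := A) inferInstance inferInstance
  obtain ⟨m, hm⟩ := Ideal.exists_maximal L
  let _ : Field (L ⧸ m) := Ideal.Quotient.field m
  have : Algebra.FiniteType K (L ⧸ m) :=
    Algebra.FiniteType.of_surjective (Ideal.Quotient.mkₐ K m) (Ideal.Quotient.mkₐ_surjective K m)
  have : Module.Finite K (L ⧸ m) := finite_of_finite_type_of_isJacobsonRing K (L ⧸ m)
  have : Algebra.IsAlgebraic K (L ⧸ m) := Algebra.IsAlgebraic.of_finite K (L ⧸ m)
  let ψ : L →ₐ[K] K := (IsAlgClosed.lift : (L ⧸ m) →ₐ[K] K).comp (Ideal.Quotient.mkₐ K m)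
  refine ⟨ψ.comp (IsScalarTower.toAlgHom K A L), ?_⟩
  have hu : IsUnit (algebraMap A L f) := IsLocalization.Away.algebraMap_isUnit f
  exact (hu.map ψ).ne_zero

theorem inter_nonempty {V W : Set (Pt K A)} (hV : IsOpen V) (hV' : V.Nonempty)
    (hW : IsOpen W) (hW' : W.Nonempty) : (V ∩ W).Nonempty := by
  obtain ⟨f, hf, hfV⟩ := exists_basic_subset hV hV'
  obtain ⟨g, hg, hgW⟩ := exists_basic_subset hW hW'
  obtain ⟨x, hx⟩ := exists_eval_ne_zero (K := K) (mul_ne_zero hf hg)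
  rw [map_mul] at hx
  exact ⟨x, hfV x (left_ne_zero_of_mul hx), hgW x (right_ne_zero_of_mul hx)⟩

theorem equivalent_equivalence :
    Equivalence (Equivalent : Subgroup (A ≃ₐ[K] A) → Subgroup (A ≃ₐ[K] A) → Prop) where
  refl _ := by
    obtain ⟨x, -⟩ := exists_eval_ne_zero (K := K) (one_ne_zero (α := A))
    exact ⟨Set.univ, isOpen_univ, ⟨x, trivial⟩, fun _ _ => rfl⟩
  symm := fun ⟨W, hW, hne, h⟩ => ⟨W, hW, hne, fun x hx => (h x hx).symm⟩
  trans := fun ⟨V, hV, hV', h⟩ ⟨W, hW, hW', h'⟩ =>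
    ⟨V ∩ W, hV.inter hW, inter_nonempty hV hV' hW hW', fun x hx => by
      rw [← Set.inter_assoc, h x hx.1, Set.inter_assoc, Set.inter_comm V W, ← Set.inter_assoc,
        h' x hx.2, Set.inter_assoc]⟩

end Irreducible

/-! ### The group `G = SL₂ × T'` -/

/-- `G = SL₂ × T'`, where `T' = (Kˣ)ⁿ`. -/
abbrev G (K : Type*) [Field K] (n : ℕ) : Type _ := SL(2, K) × (Fin n → Kˣ)

section Group

variable (K : Type*) [Field K] (n : ℕ)

/-- The algebra `K[G]` of regular functions on `G`, as functions `G → K`: it is generated by the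
matrix entries on `SL₂`, and by the coordinates on `T'` and their inverses. -/
def regularFunctions : Subalgebra K (G K n → K) :=
  Algebra.adjoin K
    ({c | ∃ i j, c = fun g => g.1 i j} ∪
      {c | ∃ i, c = fun g => ((g.2 i : Kˣ) : K)} ∪
      {c | ∃ i, c = fun g => (((g.2 i)⁻¹ : Kˣ) : K)})

/-- The standard Borel subgroup of `G`: upper triangular matrices times `T'`. -/
def stdBorel : Subgroup (G K n) where
  carrier := {g | g.1 1 0 = 0}
  mul_mem' {a b} ha hb := by
    simp only [Set.mem_ofPred_eq] at ha hb ⊢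
    simp [Matrix.mul_apply, Fin.sum_univ_two, ha, hb]
  one_mem' := by simp
  inv_mem' {a} ha := by
    simp only [Set.mem_ofPred_eq] at ha ⊢
    simp [Matrix.SpecialLinearGroup.SL2_inv_expl, ha]

/-- The standard maximal torus of `G`: diagonal matrices times `T'`. -/
def stdTorus : Subgroup (G K n) where
  carrier := {g | g.1 1 0 = 0 ∧ g.1 0 1 = 0}
  mul_mem' {a b} ha hb := by
    simp only [Set.mem_ofPred_eq] at ha hb ⊢
    simp [Matrix.mul_apply, Fin.sum_univ_two, ha, hb]
  one_mem' := by simp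
  inv_mem' {a} ha := by
    simp only [Set.mem_ofPred_eq] at ha ⊢
    simp [Matrix.SpecialLinearGroup.SL2_inv_expl, ha]

/-- The unipotent radical of the standard Borel subgroup: upper unitriangular matrices. -/
def stdUnipotent : Subgroup (G K n) where
  carrier := {g | g.1 1 0 = 0 ∧ g.1 0 0 = 1 ∧ g.1 1 1 = 1 ∧ g.2 = 1}
  mul_mem' {a b} ha hb := by
    simp only [Set.mem_ofPred_eq] at ha hb ⊢
    simp [Matrix.mul_apply, Fin.sum_univ_two, ha, hb]
  one_mem' := by simp
  inv_mem' {a} ha := by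
    simp only [Set.mem_ofPred_eq] at ha ⊢
    simp [Matrix.SpecialLinearGroup.SL2_inv_expl, ha]

variable {K n}

/-- An arbitrary Borel subgroup `B` of `G`; all of them are conjugate. -/
def borel (γ : G K n) : Subgroup (G K n) := (stdBorel K n).map (MulAut.conj γ).toMonoidHom

/-- An arbitrary maximal torus `T` of `B`; all pairs `T ⊂ B` are conjugate. -/
def torus (γ : G K n) : Subgroup (G K n) := (stdTorus K n).map (MulAut.conj γ).toMonoidHom

/-- The unipotent radical `U` of `B`. -/
def unipotent (γ : G K n) : Subgroup (G K n) :=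
  (stdUnipotent K n).map (MulAut.conj γ).toMonoidHom

end Group

/-! ### `G`-varieties, `B`-root subgroups -/

section Action

variable {K A : Type*} [Field K] [CommRing A] [Algebra K A] {n : ℕ}

/-- The action of `G` on `X` given by `ρ : G → Aut(X)` is regular: for each `f ∈ K[X]` the
function `g ↦ g · f` belongs to `K[G] ⊗ K[X]`. -/
def IsRegularAction (ρ : G K n →* (A ≃ₐ[K] A)) : Prop :=
  ∀ f : A, ∃ (m : ℕ) (c : Fin m → G K n → K) (a : Fin m → A),
    (∀ i, c i ∈ regularFunctions K n) ∧ ∀ g, ρ g f = ∑ i, c i g • a i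

/-- A subgroup `S` of `G` has an open orbit in `X`. -/
def HasOpenOrbit (ρ : G K n →* (A ≃ₐ[K] A)) (S : Subgroup (G K n)) : Prop :=
  ∃ x : Pt K A, IsOpen (orbit (S.map ρ) x)

/-- A `B`-root subgroup: a `𝔾ₐ`-subgroup of `Aut(X)` normalized by (the image of) `B`. -/
def IsBRootSubgroup (ρ : G K n →* (A ≃ₐ[K] A)) (γ : G K n) (H : Subgroup (A ≃ₐ[K] A)) : Prop :=
  IsGaSubgroup H ∧ ∀ b ∈ borel γ, ∀ h ∈ H, ρ b * h * (ρ b)⁻¹ ∈ H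

/-- `H` is vertical if it acts trivially on the algebra `K[X]^U` of `U`-invariants. -/
def IsVertical (ρ : G K n →* (A ≃ₐ[K] A)) (γ : G K n) (H : Subgroup (A ≃ₐ[K] A)) : Prop :=
  ∀ f : A, (∀ u ∈ unipotent γ, ρ u f = f) → ∀ h ∈ H, h f = f

/-- Horizontal `B`-root subgroups: the `B`-root subgroups that are not vertical. -/
def HorizontalBRootSubgroup (ρ : G K n →* (A ≃ₐ[K] A)) (γ : G K n) : Type _ :=
  {H : Subgroup (A ≃ₐ[K] A) // IsBRootSubgroup ρ γ H ∧ ¬ IsVertical ρ γ H}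

/-- Equivalence of horizontal `B`-root subgroups. -/
instance horizontalSetoid [IsAlgClosed K] [IsDomain A] [Algebra.FiniteType K A]
    (ρ : G K n →* (A ≃ₐ[K] A)) (γ : G K n) : Setoid (HorizontalBRootSubgroup ρ γ) where
  r H₁ H₂ := Equivalent H₁.1 H₂.1
  iseqv := equivalent_equivalence.comap Subtype.val

/-- `G`-stable prime divisors on `X`. -/
def GStablePrimeDivisor (ρ : G K n →* (A ≃ₐ[K] A)) : Type _ :=
  {D : PrimeDivisor K A // IsStable ρ.range (D.1 : Set (Pt K A))}

/-- `H` moves the prime divisor `D` if `D` is not `H`-stable. -/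
def Moves (H : Subgroup (A ≃ₐ[K] A)) (D : PrimeDivisor K A) : Prop :=
  ¬ IsStable H (D.1 : Set (Pt K A))

end Action

end AffineVar

end

/-!
Conjugating by `γ`, one may assume that `B` is the group of upper triangular matrices times `T'`.

*Toric coordinates.* Since the torus `T` has an open orbit, a weight vector of `T` in `K[X]` is
determined by its weight and its value at a point of that orbit, so that weight spaces have
dimension at most one. So `K[X]` has a basis of weight vectors `mon m`, with `m` running over a
submonoid `S` of the weight lattice, which multiply as the elements of `S` add
(`exists_monomialBasis`). The convex geometry of the cone of `S` is not needed: a *Demazure root* is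
encoded by its degree `e` and an additive function `d : S → ℕ` such that `m + e ∈ S` and `d (m + e)
= d m - 1` whenever `d m > 0` (`IsRoot`). In place of the ray of the root there is the prime ideal
spanned by the monomials with `d > 0`; unless `d = 0`, it has height one
(`MonomialBasis.height_faceIdeal`), and it determines `d` (`IsRoot.eq_of_face_eq`).

*Root subgroups.* Actions of the additive group correspond to locally nilpotent derivations
(`exists_isFlow`, `exists_flow_of_locallyNilpotent`). If the action is normalized by `T`, its
derivation `D` is homogeneous and has the form `mon m ↦ c * d m • mon (m + e)` for a Demazure root
(`MonomialBasis.IsTorusAction.exists_isHomogeneous`). This applies to the two root subgroups of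
`SL₂`, with derivations `up` and `low` of opposite degrees, and to every `B`-root subgroup, whose
derivation in addition commutes with `up` (`Frame.exists_isGenerator`). Among the prime divisors
stable under `T`, the one given by the ideal of `d` is the only one that `D` moves
(`Frame.IsGenerator.not_stable_iff`).

*The divisor of a horizontal subgroup.* If `D` does not vanish on the kernel of `up`, then
commutation forces `d` to be invariant under the shift by the degree of `up`, hence also under that
by the degree of `low`. So the divisor moved by `D` is stable under `G`
(`Frame.IsGenerator.stable_faceIdeal`). If `D` vanishes on the kernel of `up`, then its divisor is
the one moved by `up`, and so it is not stable under `G` (`Frame.IsGenerator.horizontal_of_stable`).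

*Bijectivity.* Two subgroups moving the same divisor have the same `d`. The derivations then agree
up to scaling after multiplication by monomials invariant under both, so that generic orbits agree;
conversely, equivalent subgroups have the same invariants (`Frame.IsGenerator.equivalent_iff`).
Finally, let `Q` be the prime ideal of a `G`-stable divisor. By normality the local ring at `Q` is a
discrete valuation ring, and comparing a uniformizing monomial with a denominator outside `Q` yields
a Demazure root for its valuation (`MonomialBasis.exists_isRoot`). The root can be shifted by the
degree of `up` until its derivation commutes with `up` (`MonomialBasis.exists_isRoot_shift_eq`).
-/

noncomputable section

namespace AffineVar

/-! ### Prime divisors and prime ideals of height one -/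

section Divisors

variable {K A : Type*} [Field K] [CommRing A] [Algebra K A]

theorem Pt.isClosed_setOf_eval_eq_zero (f : A) : IsClosed {x : Pt K A | x.eval f = 0} := by
  refine isClosed_induced_iff.2
    ⟨PrimeSpectrum.zeroLocus {f}, PrimeSpectrum.isClosed_zeroLocus _, ?_⟩
  ext x
  simp [PrimeSpectrum.mem_zeroLocus, RingHom.mem_ker]

theorem Pt.isOpen_setOf_eval_ne_zero (f : A) : IsOpen {x : Pt K A | x.eval f ≠ 0} :=
  (Pt.isClosed_setOf_eval_eq_zero f).isOpen_compl

theorem exists_basic_nhds {W : Set (Pt K A)} (hW : IsOpen W) {x : Pt K A} (hx : x ∈ W) :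
    ∃ f : A, x.eval f ≠ 0 ∧ ∀ y : Pt K A, y.eval f ≠ 0 → y ∈ W := by
  obtain ⟨V, hV, rfl⟩ := isOpen_induced_iff.1 hW
  obtain ⟨_, ⟨f, rfl⟩, hxf, hfV⟩ :=
    PrimeSpectrum.isTopologicalBasis_basic_opens.exists_subset_of_mem_open hx hV
  exact ⟨f, hxf, fun y hy => hfV hy⟩

/-- The ideal of regular functions vanishing on a set of points. -/
def vanishing (D : Set (Pt K A)) : Ideal A where
  carrier := {f | ∀ x ∈ D, x.eval f = 0}
  add_mem' hf hg x hx := by rw [map_add, hf x hx, hg x hx, add_zero]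
  zero_mem' x _ := map_zero _
  smul_mem' c f hf x hx := by rw [smul_eq_mul, map_mul, hf x hx, mul_zero]

/-- The common zeros of the functions in an ideal. -/
def zeros (P : Ideal A) : Set (Pt K A) := {x | ∀ f ∈ P, x.eval f = 0}

theorem mem_zeros {P : Ideal A} {x : Pt K A} : x ∈ zeros P ↔ ∀ f ∈ P, x.eval f = 0 := Iff.rfl

theorem isClosed_zeros (P : Ideal A) : IsClosed (zeros P : Set (Pt K A)) := by
  have : (zeros P : Set (Pt K A)) = ⋂ f ∈ P, {x : Pt K A | x.eval f = 0} := by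
    ext x; simp [mem_zeros]
  rw [this]
  exact isClosed_biInter fun f _ => Pt.isClosed_setOf_eval_eq_zero f

theorem zeros_vanishing {D : Set (Pt K A)} (hD : IsClosed D) : zeros (vanishing D) = D := by
  refine subset_antisymm (fun x hx => ?_) fun x hx f hf => hf x hx
  by_contra hxD
  obtain ⟨f, hf, hfD⟩ := exists_basic_nhds hD.isOpen_compl hxD
  refine hf (hx f fun y hy => ?_)
  by_contra hyf
  exact hfD y hyf hy

theorem isPrime_vanishing {D : Set (Pt K A)} (hD : IsIrreducible D) : (vanishing D).IsPrime := by
  refine ⟨fun h => ?_, fun {f g} hfg => ?_⟩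
  · obtain ⟨x, hx⟩ := hD.nonempty
    have h1 : (1 : A) ∈ vanishing D := h ▸ Submodule.mem_top
    exact one_ne_zero ((map_one x.eval).symm.trans (h1 x hx))
  · refine isPreirreducible_iff_isClosed_union_isClosed.1 hD.isPreirreducible _ _
      (Pt.isClosed_setOf_eval_eq_zero f) (Pt.isClosed_setOf_eval_eq_zero g) fun x hx => ?_
    have := hfg x hx
    rw [map_mul] at this
    exact mul_eq_zero.1 this

/-- The action of `φ` on points preserves `D` if `φ⁻¹` preserves the ideal of `D`, and
conversely. -/
theorem isStable_iff_vanishing {D : Set (Pt K A)} (hD : IsClosed D)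
    (H : Subgroup (A ≃ₐ[K] A)) :
    IsStable H D ↔ ∀ h ∈ H, ∀ f ∈ vanishing D, h f ∈ vanishing D := by
  constructor
  · intro hs h hh f hf x hx
    have := hf _ (hs h⁻¹ (inv_mem hh) x hx)
    rwa [eval_smul, inv_inv] at this
  · intro hs h hh x hx
    rw [← zeros_vanishing hD] at hx ⊢
    intro f hf
    rw [eval_smul]
    exact hx _ (hs h⁻¹ (inv_mem hh) f hf)

variable [IsAlgClosed K] [Algebra.FiniteType K A]

/-- Hilbert's Nullstellensatz for a prime ideal. -/
theorem exists_mem_zeros_eval_ne_zero {P : Ideal A} [P.IsPrime] {f : A} (hf : f ∉ P) :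
    ∃ x ∈ (zeros P : Set (Pt K A)), x.eval f ≠ 0 := by
  have : Algebra.FiniteType K (A ⧸ P) :=
    Algebra.FiniteType.of_surjective (Ideal.Quotient.mkₐ K P) (Ideal.Quotient.mkₐ_surjective K P)
  obtain ⟨y, hy⟩ := exists_eval_ne_zero (K := K) (A := A ⧸ P)
    (f := Ideal.Quotient.mk P f) (by rwa [Ne, Ideal.Quotient.eq_zero_iff_mem])
  refine ⟨y.eval.comp (Ideal.Quotient.mkₐ K P), fun g hg => ?_, hy⟩
  change y.eval (Ideal.Quotient.mk P g) = 0
  rw [Ideal.Quotient.eq_zero_iff_mem.2 hg, map_zero]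

theorem eq_zero_of_forall_eval_eq_zero [IsDomain A] {f : A}
    (hf : ∀ x : Pt K A, x.eval f = 0) : f = 0 := by
  by_contra h
  obtain ⟨x, hx⟩ := exists_eval_ne_zero (K := K) h
  exact hx (hf x)

theorem vanishing_zeros (P : Ideal A) [P.IsPrime] :
    vanishing (zeros P : Set (Pt K A)) = P := by
  refine le_antisymm (fun f hf => ?_) fun f hf x hx => hx f hf
  by_contra hfP
  obtain ⟨x, hx, hxf⟩ := exists_mem_zeros_eval_ne_zero (K := K) hfP
  exact hxf (hf x hx)

theorem isIrreducible_zeros (P : Ideal A) [hP : P.IsPrime] :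
    IsIrreducible (zeros P : Set (Pt K A)) := by
  refine ⟨?_, fun V W hV hW ⟨x, hx, hxV⟩ ⟨y, hy, hyW⟩ => ?_⟩
  · obtain ⟨x, hx, -⟩ := exists_mem_zeros_eval_ne_zero (K := K)
      (fun h => hP.ne_top ((Ideal.eq_top_iff_one P).2 h))
    exact ⟨x, hx⟩
  · obtain ⟨f, hf, hfV⟩ := exists_basic_nhds hV hxV
    obtain ⟨g, hg, hgW⟩ := exists_basic_nhds hW hyW
    obtain ⟨z, hz, hzfg⟩ := exists_mem_zeros_eval_ne_zero (K := K) (P := P) (f := f * g)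
      fun h => (hP.mem_or_mem h).elim (fun h => hf (hx f h)) fun h => hg (hy g h)
    rw [map_mul] at hzfg
    exact ⟨z, hz, hfV z (left_ne_zero_of_mul hzfg), hgW z (right_ne_zero_of_mul hzfg)⟩

variable (K A) in
/-- Irreducible closed subsets of `X` correspond to prime ideals of `K[X]`, reversing
inclusions. -/
def irreducibleClosedsOrderIso :
    TopologicalSpace.IrreducibleCloseds (Pt K A) ≃o (PrimeSpectrum A)ᵒᵈ where
  toFun D := OrderDual.toDual ⟨vanishing (D : Set (Pt K A)), isPrime_vanishing D.isIrreducible⟩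
  invFun P :=
    { carrier := zeros (OrderDual.ofDual P).asIdeal
      isIrreducible' := isIrreducible_zeros _
      isClosed' := isClosed_zeros _ }
  left_inv D := by
    apply TopologicalSpace.IrreducibleCloseds.ext
    exact zeros_vanishing D.isClosed
  right_inv P := by
    apply congrArg OrderDual.toDual
    apply PrimeSpectrum.ext
    exact vanishing_zeros (OrderDual.ofDual P).asIdeal
  map_rel_iff' := by
    intro D E
    change vanishing (E : Set (Pt K A)) ≤ vanishing (D : Set (Pt K A)) ↔ (D : Set (Pt K A)) ⊆ E
    refine ⟨fun h => ?_, fun h f hf x hx => hf x (h hx)⟩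
    rw [← zeros_vanishing D.isClosed, ← zeros_vanishing E.isClosed]
    exact fun x hx f hf => hx f (h hf)

instance PrimeDivisor.isPrime (D : PrimeDivisor K A) :
    (vanishing (D.1 : Set (Pt K A))).IsPrime := isPrime_vanishing D.1.isIrreducible

theorem height_vanishing (D : TopologicalSpace.IrreducibleCloseds (Pt K A)) :
    (vanishing (D : Set (Pt K A))).height = Order.coheight D := by
  rw [← Order.coheight_orderIso (irreducibleClosedsOrderIso K A)]
  exact PrimeSpectrum.height_eq_orderHeight ⟨_, isPrime_vanishing D.isIrreducible⟩

theorem PrimeDivisor.height_eq_one (D : PrimeDivisor K A) :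
    (vanishing (D.1 : Set (Pt K A))).height = 1 := (height_vanishing D.1).trans D.2

theorem PrimeDivisor.ext_vanishing {D E : PrimeDivisor K A}
    (h : vanishing (D.1 : Set (Pt K A)) = vanishing (E.1 : Set (Pt K A))) : D = E :=
  Subtype.ext ((irreducibleClosedsOrderIso K A).injective
    (congrArg OrderDual.toDual (PrimeSpectrum.ext h)))

theorem PrimeDivisor.exists_vanishing_eq {P : Ideal A} (hP : P.IsPrime) (h : P.height = 1) :
    ∃ D : PrimeDivisor K A, vanishing (D.1 : Set (Pt K A)) = P := by
  let D := (irreducibleClosedsOrderIso K A).symm (OrderDual.toDual ⟨P, hP⟩)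
  have hD : vanishing (D : Set (Pt K A)) = P := vanishing_zeros P
  exact ⟨⟨D, by rw [← height_vanishing, hD, h]⟩, hD⟩

/-- In a domain, a prime ideal of height one does not properly contain a nonzero prime ideal. -/
theorem eq_of_le_of_height_eq_one {B : Type*} [CommRing B] [IsDomain B] {P Q : Ideal B}
    [P.IsPrime] [Q.IsPrime] (hQ : Q.height = 1) (hP : P ≠ ⊥) (h : P ≤ Q) : P = Q := by
  by_contra hne
  have h1 := Ideal.height_add_one_le_of_lt_of_isPrime (lt_of_le_of_ne h hne)
  have h2 : P.height ≠ 0 := by rwa [Ne, Ideal.height_eq_zero_iff_eq_bot]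
  rw [hQ] at h1
  have h3 : (1 : ℕ∞) ≤ P.height := Order.one_le_iff_ne_zero.2 h2
  have := (add_le_add_left h3 1).trans h1
  norm_num at this

end Divisors

/-! ### Additive group actions and locally nilpotent derivations -/

section AdditiveActions

open Polynomial Finset.HasAntidiagonal

section Flows

variable {K A : Type*} [Field K] [CommRing A] [Algebra K A]

/-- The derivation `D` generates the action `σ` of the additive group: for each `f ∈ K[X]` the
function `s ↦ σ(s) f` is the polynomial `∑ sᵏ Dᵏ f / k!`. Since polynomials have finitely many
coefficients, this forces `D` to be locally nilpotent when `K` has characteristic zero. -/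
def IsFlow (σ : Multiplicative K →* (A ≃ₐ[K] A)) (D : Derivation K A A) : Prop :=
  ∀ f : A, ∃ p : A[X], (∀ k, p.coeff k = ((k.factorial : K)⁻¹) • (D^[k]) f) ∧
    ∀ s : K, σ (Multiplicative.ofAdd s) f = p.eval (algebraMap K A s)

theorem derivation_iterate_smul (D : Derivation K A A) (k : ℕ) (c : K) (f : A) :
    (D^[k]) (c • f) = c • (D^[k]) f := by
  induction k generalizing f with
  | zero => rfl
  | succ k ih => rw [Function.iterate_succ_apply, D.map_smul, ih, Function.iterate_succ_apply]

theorem derivation_iterate_mul (D : Derivation K A A) (n : ℕ) (f g : A) :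
    (D^[n]) (f * g) = ∑ ij ∈ antidiagonal n,
      n.choose ij.1 • ((D^[ij.1]) f * (D^[ij.2]) g) := by
  induction n with
  | zero => simp
  | succ n ih =>
    rw [Finset.sum_antidiagonal_choose_succ_nsmul (fun i j => (D^[i]) f * (D^[j]) g) n]
    simp only [Function.iterate_succ_apply', ih, map_sum, map_nsmul, Derivation.leibniz,
      smul_add, Finset.sum_add_distrib, smul_eq_mul, add_right_inj]
    refine Finset.sum_congr rfl fun ⟨i, j⟩ hij => ?_
    rw [n.choose_symm_of_eq_add (mem_antidiagonal.1 hij).symm, mul_comm]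

/-- The Leibniz rule for divided powers of a derivation. -/
theorem derivation_dividedPower_mul [CharZero K] (D : Derivation K A A) (n : ℕ) (f g : A) :
    ((n.factorial : K)⁻¹) • (D^[n]) (f * g) = ∑ ij ∈ antidiagonal n,
      (((ij.1.factorial : K)⁻¹) • (D^[ij.1]) f) * (((ij.2.factorial : K)⁻¹) • (D^[ij.2]) g) := by
  rw [derivation_iterate_mul, Finset.smul_sum]
  refine Finset.sum_congr rfl fun ⟨i, j⟩ hij => ?_
  rw [← Nat.cast_smul_eq_nsmul K, smul_smul, smul_mul_smul_comm]
  congr 1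
  obtain rfl := mem_antidiagonal.1 hij
  dsimp only
  rw [Nat.choose_symm_add, Nat.add_choose,
    Nat.cast_div (Nat.factorial_mul_factorial_dvd_factorial_add i j)
    (by exact_mod_cast (Nat.mul_pos i.factorial_pos j.factorial_pos).ne')]
  have h1 : ((i + j).factorial : K) ≠ 0 := by exact_mod_cast (Nat.factorial_ne_zero _)
  push_cast
  field_simp

theorem infinite_range_algebraMap [CharZero K] [Nontrivial A] :
    (Set.range (algebraMap K A)).Infinite :=
  Set.infinite_range_of_injective (FaithfulSMul.algebraMap_injective K A)

theorem polynomial_eq_of_eval_algebraMap_eq [CharZero K] [IsDomain A] {p q : A[X]}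
    (h : ∀ s : K, p.eval (algebraMap K A s) = q.eval (algebraMap K A s)) : p = q := by
  refine Polynomial.eq_of_infinite_eval_eq p q
    ((infinite_range_algebraMap (K := K) (A := A)).mono ?_)
  rintro _ ⟨s, rfl⟩
  exact h s

theorem exists_polynomial_map_coeff {B : Type*} [CommRing B] [Algebra K B] (L : A →ₗ[K] B)
    (p : A[X]) : ∃ q : B[X], (∀ k, q.coeff k = L (p.coeff k)) ∧
      ∀ s : K, q.eval (algebraMap K B s) = L (p.eval (algebraMap K A s)) := by
  refine ⟨∑ k ∈ Finset.range (p.natDegree + 1), monomial k (L (p.coeff k)), fun k => ?_,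
    fun s => ?_⟩
  · simp only [finsetSum_coeff, coeff_monomial, Finset.sum_ite_eq', Finset.mem_range]
    split_ifs with hk
    · rfl
    · rw [coeff_eq_zero_of_natDegree_lt (by omega), map_zero]
  · rw [eval_finsetSum, eval_eq_sum_range (p := p), map_sum]
    refine Finset.sum_congr rfl fun k _ => ?_
    rw [eval_monomial, ← map_pow, ← map_pow, mul_comm _ (algebraMap K A _),
      mul_comm _ (algebraMap K B _), ← Algebra.smul_def, ← Algebra.smul_def, map_smul]

/-- Every action of the additive group is generated by a derivation. -/
theorem exists_isFlow [CharZero K] [IsDomain A] {σ : Multiplicative K →* (A ≃ₐ[K] A)}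
    (hσ : ∀ f : A, ∃ p : A[X], ∀ s : K,
      σ (Multiplicative.ofAdd s) f = p.eval (algebraMap K A s)) :
    ∃ D : Derivation K A A, IsFlow σ D := by
  choose p hp using hσ
  have huniq : ∀ f (q : A[X]), (∀ s : K, σ (Multiplicative.ofAdd s) f = q.eval (algebraMap K A s)) →
      p f = q := fun f q hq =>
    polynomial_eq_of_eval_algebraMap_eq (K := K) fun s => (hp f s).symm.trans (hq s)
  have hadd : ∀ f g, p (f + g) = p f + p g := fun f g =>
    huniq _ _ fun s => by rw [map_add, hp, hp, eval_add]
  have hmul : ∀ f g, p (f * g) = p f * p g := fun f g =>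
    huniq _ _ fun s => by rw [map_mul, hp, hp, eval_mul]
  have hsmul : ∀ (c : K) f, p (c • f) = c • p f := fun c f =>
    huniq _ _ fun s => by rw [map_smul, hp, Polynomial.eval_smul]
  have h0 : ∀ f, (p f).coeff 0 = f := fun f => by
    have := hp f 0
    rw [ofAdd_zero, map_one, map_zero, ← coeff_zero_eq_eval_zero] at this
    exact this.symm
  let D : Derivation K A A := Derivation.mk'
    { toFun := fun f => (p f).coeff 1
      map_add' := fun f g => by rw [hadd, coeff_add]
      map_smul' := fun c f => by rw [hsmul, coeff_smul, RingHom.id_apply] }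
    fun f g => by
      change (p (f * g)).coeff 1 = f • (p g).coeff 1 + g • (p f).coeff 1
      rw [hmul, mul_coeff_one, h0, h0, smul_eq_mul, smul_eq_mul, mul_comm g]
  have hD : ∀ f, D f = (p f).coeff 1 := fun _ => rfl
  -- `σ(s) σ(t) = σ(s + t)` says that the polynomial of `σ(t) f` is a Taylor shift.
  have htaylor : ∀ f (t : K), p (σ (Multiplicative.ofAdd t) f) = taylor (algebraMap K A t) (p f) :=
    fun f t => huniq _ _ fun s => by
      rw [taylor_eval, ← map_add, ← hp, ofAdd_add, map_mul]; rfl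
  have hstep : ∀ f k, D ((p f).coeff k) = (p f).coeff (k + 1) * (k + 1) := by
    intro f
    obtain ⟨q, hqc, hqe⟩ := exists_polynomial_map_coeff D.toLinearMap (p f)
    have hq : q = derivative (p f) := by
      refine polynomial_eq_of_eval_algebraMap_eq (K := K) fun t => ?_
      rw [hqe, ← taylor_coeff_one, ← htaylor, ← hD, hp]
      rfl
    intro k
    exact (hqc k).symm.trans (by rw [hq, coeff_derivative])
  refine ⟨D, fun f => ⟨p f, fun k => ?_, hp f⟩⟩
  induction k with
  | zero => simp [h0]
  | succ k ih =>
    have h := hstep f k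
    rw [ih, D.map_smul, ← Function.iterate_succ_apply' D] at h
    have hk : ((k : K) + 1) ≠ 0 := by exact_mod_cast k.succ_ne_zero
    have h2 : (p f).coeff (k + 1) * ((k : A) + 1) = ((k : K) + 1) • (p f).coeff (k + 1) := by
      rw [Algebra.smul_def, mul_comm, map_add, map_natCast, map_one]
    rw [h2] at h
    rw [Nat.factorial_succ, Nat.cast_mul, mul_inv, mul_smul, h, smul_smul, Nat.cast_add,
      Nat.cast_one, inv_mul_cancel₀ hk, one_smul]

/-- A locally nilpotent derivation generates an action of the additive group. -/
theorem exists_flow_of_locallyNilpotent [CharZero K] {D : Derivation K A A}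
    (hD : ∀ f, ∃ N, (D^[N]) f = 0) :
    ∃ σ : Multiplicative K →* (A ≃ₐ[K] A), IsFlow σ D := by
  have hvan : ∀ f, ∃ N, ∀ k, N < k → (D^[k]) f = 0 := by
    intro f
    obtain ⟨N, hN⟩ := hD f
    refine ⟨N, fun k hk => ?_⟩
    obtain ⟨j, rfl⟩ := Nat.exists_eq_add_of_lt hk
    rw [show N + j + 1 = (j + 1) + N by omega, Function.iterate_add_apply, hN, iterate_map_zero]
  have hex : ∀ f, ∃ p : A[X], ∀ k, p.coeff k = ((k.factorial : K)⁻¹) • (D^[k]) f := by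
    intro f
    obtain ⟨N, hN⟩ := hvan f
    refine ⟨∑ k ∈ Finset.range (N + 1), monomial k (((k.factorial : K)⁻¹) • (D^[k]) f),
      fun k => ?_⟩
    simp only [finsetSum_coeff, coeff_monomial, Finset.sum_ite_eq', Finset.mem_range]
    split_ifs with hk
    · rfl
    · rw [hN k (by omega), smul_zero]
  choose φ hφ using hex
  let E (s : K) : A →ₐ[K] A :=
    { toFun := fun f => (φ f).eval (algebraMap K A s)
      map_one' := by
        have : φ 1 = 1 := by
          ext k
          rw [hφ, coeff_one]
          cases k with
          | zero => simp
          | succ k => simp [Function.iterate_succ_apply]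
        rw [this, eval_one]
      map_mul' := fun f g => by
        have : φ (f * g) = φ f * φ g := by
          ext k
          rw [hφ, derivation_dividedPower_mul, coeff_mul]
          exact Finset.sum_congr rfl fun ij _ => by rw [hφ, hφ]
        rw [this, eval_mul]
      map_zero' := by
        have : φ 0 = 0 := by
          ext k
          rw [hφ, iterate_map_zero, smul_zero, coeff_zero]
        rw [this, eval_zero]
      map_add' := fun f g => by
        have : φ (f + g) = φ f + φ g := by
          ext k
          rw [hφ, iterate_map_add, smul_add, coeff_add, hφ, hφ]
        rw [this, eval_add]
      commutes' := fun c => by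
        have : φ (algebraMap K A c) = C (algebraMap K A c) := by
          ext k
          rw [hφ, coeff_C]
          cases k with
          | zero => simp
          | succ k => simp [Function.iterate_succ_apply]
        rw [this, eval_C] }
  have hE : ∀ s f, E s f = (φ f).eval (algebraMap K A s) := fun _ _ => rfl
  have hEadd : ∀ s t f, E s (E t f) = E (s + t) f := by
    intro s t f
    obtain ⟨N, hN⟩ := hvan f
    have hdeg : ∀ j, (hasseDeriv j (φ f)).natDegree < N + 1 := fun j =>
      Nat.lt_succ_of_le (natDegree_le_iff_coeff_eq_zero.2 fun k hk => by
        rw [hasseDeriv_coeff, hφ, hN _ (by omega), smul_zero, mul_zero])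
    have : φ (E t f) = taylor (algebraMap K A t) (φ f) := by
      ext k
      have hdeg0 := hdeg 0
      rw [hasseDeriv_zero, LinearMap.id_apply] at hdeg0
      rw [hφ, taylor_coeff, hE, eval_eq_sum_range' hdeg0, eval_eq_sum_range' (hdeg k)]
      have hsum : ∀ g : ℕ → A, (D^[k]) (∑ j ∈ Finset.range (N + 1), g j) =
          ∑ j ∈ Finset.range (N + 1), (D^[k]) (g j) := by
        intro g
        induction Finset.range (N + 1) using Finset.induction with
        | empty => simp
        | insert a u ha ih => rw [Finset.sum_insert ha, Finset.sum_insert ha, iterate_map_add, ih]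
      rw [hsum, Finset.smul_sum]
      refine Finset.sum_congr rfl fun j _ => ?_
      rw [hφ, hasseDeriv_coeff, hφ, ← map_pow, mul_comm, ← Algebra.smul_def, smul_smul,
        derivation_iterate_smul, ← Function.iterate_add_apply, add_comm k j, mul_comm _
        (algebraMap K A _), ← Algebra.smul_def, ← nsmul_eq_mul, ← Nat.cast_smul_eq_nsmul K,
        smul_smul, smul_smul, smul_smul]
      congr 1
      rw [Nat.add_choose, Nat.cast_div
        (Nat.factorial_mul_factorial_dvd_factorial_add j k)
        (by exact_mod_cast (Nat.mul_pos j.factorial_pos k.factorial_pos).ne')]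
      have h1 : ((j + k).factorial : K) ≠ 0 := by exact_mod_cast (Nat.factorial_ne_zero _)
      push_cast
      field_simp
    rw [hE s, this, taylor_eval, ← map_add, ← hE]
  have hE0 : ∀ f, E 0 f = f := fun f => by
    rw [hE, map_zero, ← coeff_zero_eq_eval_zero, hφ]; simp
  refine ⟨⟨⟨fun s => AlgEquiv.ofAlgHom (E s.toAdd) (E (-s.toAdd)) ?_ ?_, ?_⟩, ?_⟩,
    fun f => ⟨φ f, hφ f, fun s => rfl⟩⟩
  · ext f
    change E _ (E _ f) = f
    rw [hEadd, add_neg_cancel, hE0]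
  · ext f
    change E _ (E _ f) = f
    rw [hEadd, neg_add_cancel, hE0]
  · ext f
    exact hE0 f
  · intro s t
    ext f
    exact (hEadd s.toAdd t.toAdd f).symm

end Flows

section FlowComparison

variable {K A : Type*} [Field K] [CommRing A] [Algebra K A]
  {σ τ : Multiplicative K →* (A ≃ₐ[K] A)} {D E : Derivation K A A}

theorem IsFlow.coeff_one {f : A} {p : A[X]}
    (hp : ∀ k, p.coeff k = ((k.factorial : K)⁻¹) • (D^[k]) f) : p.coeff 1 = D f := by
  simp [hp]

/-- Comparison of two additive group actions along two homomorphisms that intertwine the powers of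
the generating derivations up to scaling. -/
theorem IsFlow.map_eq_map {B : Type*} [CommRing B] [Algebra K B] (hσ : IsFlow σ D)
    (hτ : IsFlow τ E) (x y : A →ₐ[K] B) (c : K) {f g : A}
    (h : ∀ k, x ((D^[k]) f) = c ^ k • y ((E^[k]) g)) (s : K) :
    x (σ (Multiplicative.ofAdd s) f) = y (τ (Multiplicative.ofAdd (c * s)) g) := by
  obtain ⟨p, hp, hps⟩ := hσ f
  obtain ⟨q, hq, hqs⟩ := hτ g
  obtain ⟨p', hp', hps'⟩ := exists_polynomial_map_coeff x.toLinearMap p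
  obtain ⟨q', hq', hqs'⟩ := exists_polynomial_map_coeff y.toLinearMap q
  have : p' = q'.comp (C (algebraMap K B c) * X) := by
    ext k
    rw [comp_C_mul_X_coeff, hp', hq', hp, hq, map_smul, map_smul]
    change _ • x _ = _ • y _ * _
    rw [h, ← map_pow, mul_comm, ← Algebra.smul_def, smul_comm]
  rw [hps, hqs]
  refine (hps' s).symm.trans ((congrArg _ this).trans ?_)
  refine Eq.trans ?_ (hqs' (c * s))
  rw [eval_comp, eval_mul, eval_C, eval_X, map_mul]

theorem IsFlow.conj (hσ : IsFlow σ D) (hτ : IsFlow τ E) (φ : A ≃ₐ[K] A) (c : K)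
    (h : ∀ f, φ (D f) = c • E (φ f)) (s : K) (f : A) :
    φ (σ (Multiplicative.ofAdd s) f) = τ (Multiplicative.ofAdd (c * s)) (φ f) := by
  refine hσ.map_eq_map hτ (φ : A →ₐ[K] A) (AlgHom.id K A) c (fun k => ?_) s
  change φ _ = c ^ k • (E^[k]) (φ f)
  induction k generalizing f with
  | zero => simp
  | succ k ih =>
    rw [Function.iterate_succ_apply, ih, h, derivation_iterate_smul, smul_smul, ← pow_succ,
      Function.iterate_succ_apply]

/-- At a point where the generators are proportional by an invariant factor, the orbit of the first
action is contained in that of the second. -/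
theorem IsFlow.orbit_subset (hσ : IsFlow σ D) (hτ : IsFlow τ E) {a b : A} (hDb : D b = 0)
    (hDa : D a = 0) (h : ∀ f, b * D f = a * E f) {x : Pt K A} (hx : x.eval b ≠ 0) :
    orbit σ.range x ⊆ orbit τ.range x := by
  have hk : ∀ k f, b ^ k * (D^[k]) f = a ^ k * (E^[k]) f := by
    intro k f
    induction k with
    | zero => simp
    | succ k ih =>
      have hb : D (b ^ k) = 0 := by rw [Derivation.leibniz_pow, hDb]; simp
      have ha : D (a ^ k) = 0 := by rw [Derivation.leibniz_pow, hDa]; simp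
      have h1 := congrArg D ih
      rw [Derivation.leibniz, Derivation.leibniz, ha, hb, smul_zero, smul_zero, add_zero, add_zero,
        smul_eq_mul, smul_eq_mul] at h1
      rw [Function.iterate_succ_apply', Function.iterate_succ_apply', pow_succ', pow_succ',
        mul_assoc, h1, mul_left_comm, h]
      ring
  have hk' : ∀ k f, x.eval ((D^[k]) f) =
      (x.eval a / x.eval b) ^ k • AlgHom.id K K (x.eval ((E^[k]) f)) := by
    intro k f
    have := congrArg x.eval (hk k f)
    rw [map_mul, map_mul, map_pow, map_pow] at this
    rw [div_pow, smul_eq_mul, AlgHom.id_apply, div_mul_eq_mul_div,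
      eq_div_iff (pow_ne_zero _ hx), mul_comm, this]
  rintro _ ⟨_, ⟨s, rfl⟩, rfl⟩
  refine ⟨τ (Multiplicative.ofAdd (x.eval a / x.eval b * s.toAdd)), ⟨_, rfl⟩, ?_⟩
  apply AlgHom.ext
  intro f
  change x.eval ((τ _)⁻¹ f) = x.eval ((σ _)⁻¹ f)
  rw [← map_inv τ, ← map_inv σ]
  have := hσ.map_eq_map hτ x.eval x.eval _ (fun k => hk' k f) (-s.toAdd)
  rw [mul_neg] at this
  exact this.symm

end FlowComparison

section FlowLemmas

variable {K A : Type*} [Field K] [CharZero K] [CommRing A] [Algebra K A]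
  {σ τ : Multiplicative K →* (A ≃ₐ[K] A)} {D E : Derivation K A A}

/-- A prime ideal is stable under an additive group action if and only if it is stable under the
generating derivation. -/
theorem IsFlow.stable_iff (hσ : IsFlow σ D) (P : Ideal A) [P.IsPrime] :
    (∀ s, ∀ f ∈ P, σ s f ∈ P) ↔ ∀ f ∈ P, D f ∈ P := by
  have hmk : ∀ f, Ideal.Quotient.mkₐ K P f = 0 ↔ f ∈ P := fun f => Ideal.Quotient.eq_zero_iff_mem
  constructor
  · intro h f hf
    obtain ⟨p, hp, hps⟩ := hσ f
    obtain ⟨q, hq, hqs⟩ := exists_polynomial_map_coeff (Ideal.Quotient.mkₐ K P).toLinearMap p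
    have : q = 0 := by
      refine polynomial_eq_of_eval_algebraMap_eq (K := K) fun s => ?_
      rw [hqs, ← hps, eval_zero]
      exact (hmk _).2 (h _ f hf)
    have h1 := hq 1
    rw [this, coeff_zero, IsFlow.coeff_one hp] at h1
    exact (hmk _).1 h1.symm
  · intro h s f hf
    have hk : ∀ k, (D^[k]) f ∈ P := by
      intro k
      induction k with
      | zero => exact hf
      | succ k ih => rw [Function.iterate_succ_apply']; exact h _ ih
    obtain ⟨p, hp, hps⟩ := hσ f
    obtain ⟨q, hq, hqs⟩ := exists_polynomial_map_coeff (Ideal.Quotient.mkₐ K P).toLinearMap p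
    have : q = 0 := by
      ext k
      rw [hq, hp, map_smul, coeff_zero, AlgHom.toLinearMap_apply, (hmk _).2 (hk k), smul_zero]
    have h1 := hqs s.toAdd
    rw [this, eval_zero, ← hps] at h1
    exact (hmk _).1 h1.symm

variable [IsDomain A]

theorem IsFlow.exists_iterate_eq_zero (hσ : IsFlow σ D) (f : A) : ∃ N, (D^[N]) f = 0 := by
  obtain ⟨p, hp, -⟩ := hσ f
  refine ⟨p.natDegree + 1, ?_⟩
  have := (hp (p.natDegree + 1)).symm.trans (coeff_eq_zero_of_natDegree_lt (Nat.lt_succ_self _))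
  exact (smul_eq_zero.1 this).resolve_left
    (inv_ne_zero (by exact_mod_cast Nat.factorial_ne_zero _))

/-- If `φ` carries `σ(1)` to an element `τ(c)`, then it carries the generator of `σ` to `c` times
the generator of `τ`. -/
theorem IsFlow.conj_derivation (hσ : IsFlow σ D) (hτ : IsFlow τ E) (φ : A ≃ₐ[K] A) (c : K)
    (h : ∀ f, φ (σ (Multiplicative.ofAdd 1) f) = τ (Multiplicative.ofAdd c) (φ f)) (f : A) :
    φ (D f) = c • E (φ f) := by
  have hn : ∀ (n : ℕ) f, φ (σ (Multiplicative.ofAdd (n : K)) f) =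
      τ (Multiplicative.ofAdd (c * n)) (φ f) := by
    intro n
    induction n with
    | zero => intro f; simp
    | succ n ih =>
      intro f
      rw [Nat.cast_succ, ofAdd_add, map_mul σ, AlgEquiv.mul_apply, ih, h, mul_add, mul_one,
        ofAdd_add, map_mul τ, AlgEquiv.mul_apply]
  obtain ⟨p, hp, hps⟩ := hσ f
  obtain ⟨q, hq, hqs⟩ := hτ (φ f)
  obtain ⟨p', hp', hps'⟩ := exists_polynomial_map_coeff (φ : A →ₐ[K] A).toLinearMap p
  have : p' = q.comp (C (algebraMap K A c) * X) := by
    refine Polynomial.eq_of_infinite_eval_eq _ _ (Set.infinite_range_of_injective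
      ((FaithfulSMul.algebraMap_injective K A).comp Nat.cast_injective) |>.mono ?_)
    rintro _ ⟨n, rfl⟩
    change p'.eval (algebraMap K A n) = _
    rw [hps', Function.comp_apply, eval_comp, eval_mul, eval_C, eval_X, ← map_mul, ← hqs, ← hn,
      hps]
    rfl
  have h1 := hp' 1
  rw [this, comp_C_mul_X_coeff, IsFlow.coeff_one hp, IsFlow.coeff_one hq, pow_one, mul_comm,
    ← Algebra.smul_def] at h1
  exact h1.symm

theorem IsFlow.invariant_iff (hσ : IsFlow σ D) (f : A) : (∀ s, σ s f = f) ↔ D f = 0 := by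
  obtain ⟨p, hp, hps⟩ := hσ f
  constructor
  · intro h
    have : p = C f := polynomial_eq_of_eval_algebraMap_eq (K := K) fun s => by
      rw [← hps, h, eval_C]
    rw [← IsFlow.coeff_one hp, this, coeff_C_succ]
  · intro h s
    have : p = C f := by
      ext k
      rw [hp]
      cases k with
      | zero => simp
      | succ k => rw [Function.iterate_succ_apply, h, iterate_map_zero, smul_zero, coeff_C_succ]
    exact (hps s.toAdd).trans (by rw [this, eval_C])

theorem IsFlow.eq_one_iff (hσ : IsFlow σ D) : σ = 1 ↔ D = 0 := by
  constructor
  · rintro rfl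
    ext f
    exact (hσ.invariant_iff f).1 fun _ => rfl
  · rintro rfl
    ext s f
    exact (hσ.invariant_iff f).2 rfl s

/-- A derivation commutes with an additive group action if and only if it commutes with its
generator. -/
theorem IsFlow.commute_iff (hσ : IsFlow σ D) (E : Derivation K A A) :
    (∀ s f, E (σ s f) = σ s (E f)) ↔ ∀ f, E (D f) = D (E f) := by
  constructor
  · intro h f
    obtain ⟨p, hp, hps⟩ := hσ f
    obtain ⟨q, hq, hqs⟩ := hσ (E f)
    obtain ⟨p', hp', hps'⟩ := exists_polynomial_map_coeff E.toLinearMap p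
    have : p' = q := polynomial_eq_of_eval_algebraMap_eq (K := K) fun s => by
      rw [hps', ← hps, ← hqs, ← h]; rfl
    have h1 := hp' 1
    rw [this, IsFlow.coeff_one hp, IsFlow.coeff_one hq] at h1
    exact h1.symm
  · intro h s f
    obtain ⟨p, hp, hps⟩ := hσ f
    obtain ⟨q, hq, hqs⟩ := hσ (E f)
    obtain ⟨p', hp', hps'⟩ := exists_polynomial_map_coeff E.toLinearMap p
    have hk : ∀ k, E ((D^[k]) f) = (D^[k]) (E f) := by
      intro k
      induction k with
      | zero => rfl
      | succ k ih => rw [Function.iterate_succ_apply', h, ih, Function.iterate_succ_apply']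
    have : p' = q := by
      ext k
      rw [hp', hp, hq, map_smul, ← hk]; rfl
    have h1 := hps' s.toAdd
    rw [this, ← hqs, ← hps] at h1
    exact h1.symm

end FlowLemmas

section Equivalence

variable {K A : Type*} [Field K] [IsAlgClosed K] [CommRing A] [IsDomain A]
  [Algebra K A] [Algebra.FiniteType K A]
  {σ τ : Multiplicative K →* (A ≃ₐ[K] A)} {D E : Derivation K A A}

/-- Two additive group actions whose generators are proportional over the field of rational
invariants have the same generic orbits. -/
theorem IsFlow.equivalent_of_mul_eq (hσ : IsFlow σ D) (hτ : IsFlow τ E) {a b : A} (ha : a ≠ 0)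
    (hb : b ≠ 0) (hDa : D a = 0) (hDb : D b = 0) (hEa : E a = 0) (hEb : E b = 0)
    (h : ∀ f, b * D f = a * E f) : Equivalent σ.range τ.range := by
  obtain ⟨x, hx⟩ := exists_eval_ne_zero (K := K) (mul_ne_zero ha hb)
  refine ⟨_, Pt.isOpen_setOf_eval_ne_zero (a * b), ⟨x, hx⟩, fun y hy => ?_⟩
  have hy' : y.eval (a * b) ≠ 0 := hy
  rw [map_mul] at hy'
  rw [subset_antisymm (hσ.orbit_subset hτ hDb hDa h (right_ne_zero_of_mul hy'))
    (hτ.orbit_subset hσ hEa hEb (fun f => (h f).symm) (left_ne_zero_of_mul hy'))]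

/-- Equivalent additive group actions have the same invariant functions: an invariant of the first
is constant along the generic orbits of the second. -/
theorem IsFlow.eq_zero_of_equivalent [CharZero K] (hσ : IsFlow σ D) (hτ : IsFlow τ E)
    (h : Equivalent σ.range τ.range) {f : A} (hf : D f = 0) : E f = 0 := by
  obtain ⟨W, hW, hne, hWorb⟩ := h
  obtain ⟨g, hg, hgW⟩ := exists_basic_subset hW hne
  refine (mul_eq_zero.1 (eq_zero_of_forall_eval_eq_zero (K := K) (f := E f * g)
    fun x => ?_)).resolve_right hg
  rw [map_mul, mul_eq_zero]
  by_contra! hx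
  obtain ⟨hx, hxg⟩ := hx
  obtain ⟨p, hp, hps⟩ := hτ f
  obtain ⟨q, hq, hqs⟩ := hτ g
  obtain ⟨p', hp', hps'⟩ := exists_polynomial_map_coeff x.eval.toLinearMap p
  obtain ⟨q', hq', hqs'⟩ := exists_polynomial_map_coeff x.eval.toLinearMap q
  -- `p'` and `q'` describe `f` and `g` along the second orbit of `x`; the points of that orbit
  -- where `g` does not vanish belong to `W`, hence to the first orbit, where `f` is constant.
  have hmul : (p' - C (x.eval f)) * q' = 0 := by
    refine polynomial_eq_of_eval_algebraMap_eq (K := K) fun s => ?_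
    rw [eval_zero, eval_mul, mul_eq_zero, or_iff_not_imp_right, hqs', eval_sub, eval_C, hps',
      ← hps, ← hqs]
    intro hs
    have hmem : (τ (Multiplicative.ofAdd (-s))) • x ∈ orbit τ.range x ∩ W := by
      refine ⟨⟨_, ⟨_, rfl⟩, rfl⟩, hgW _ ?_⟩
      rw [eval_smul, ← map_inv, ofAdd_neg, inv_inv]
      exact hs
    rw [← hWorb x (hgW x hxg)] at hmem
    obtain ⟨⟨_, ⟨r, rfl⟩, hr⟩, -⟩ := hmem
    have h1 := congrArg (fun y : Pt K A => y.eval f) hr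
    simp only [eval_smul, ← map_inv, ofAdd_neg, inv_inv] at h1
    rw [(hσ.invariant_iff f).2 hf] at h1
    rw [sub_eq_zero]
    exact h1.symm
  have hq0 : q' ≠ 0 := by
    intro h0
    have := hq' 0
    rw [h0, hq] at this
    simp at this
    exact hxg this.symm
  have h2 := (mul_eq_zero.1 hmul).resolve_right hq0
  have h3 := hp' 1
  rw [sub_eq_zero.1 h2, IsFlow.coeff_one hp, coeff_C_succ] at h3
  exact hx h3.symm

end Equivalence

end AdditiveActions

/-! ### Coordinate algebras of toric varieties -/

/-- A basis of an algebra consisting of monomials `mon m`, where `m` runs through a submonoid `S`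
of an abelian group `M`. The values of `mon` outside `S` are irrelevant. -/
structure MonomialBasis (K A M : Type*) [Field K] [CommRing A] [Algebra K A]
    [AddCommGroup M] where
  /-- The monoid of exponents. -/
  S : AddSubmonoid M
  /-- The monomials. -/
  mon : M → A
  /-- The coefficients in the expansion with respect to the monomials. -/
  coef : A →ₗ[K] (M →₀ K)
  mon_zero : mon 0 = 1
  mon_add : ∀ {m m'}, m ∈ S → m' ∈ S → mon (m + m') = mon m * mon m'
  coef_mon : ∀ {m}, m ∈ S → coef (mon m) = Finsupp.single m 1
  mem_of_coef_ne_zero : ∀ {f m}, coef f m ≠ 0 → m ∈ S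
  coef_injective : Function.Injective coef

namespace MonomialBasis

variable {K A M : Type*} [Field K] [CommRing A] [Algebra K A] [AddCommGroup M]
  (B : MonomialBasis K A M)

theorem mon_ne_zero {m : M} (hm : m ∈ B.S) : B.mon m ≠ 0 := by
  intro h
  have := B.coef_mon hm
  rw [h, map_zero] at this
  have := DFunLike.congr_fun this m
  simp at this

theorem eq_sum (f : A) : f = (B.coef f).sum fun m c => c • B.mon m := by
  apply B.coef_injective
  rw [Finsupp.sum, map_sum]
  conv_lhs => rw [← Finsupp.sum_single (B.coef f)]
  refine Finset.sum_congr rfl fun m hm => ?_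
  rw [map_smul, B.coef_mon (B.mem_of_coef_ne_zero (Finsupp.mem_support_iff.1 hm)),
    Finsupp.smul_single, smul_eq_mul, mul_one]

theorem induction {p : A → Prop} (f : A) (mon : ∀ m ∈ B.S, p (B.mon m)) (zero : p 0)
    (add : ∀ f g, p f → p g → p (f + g)) (smul : ∀ (c : K) f, p f → p (c • f)) : p f := by
  rw [B.eq_sum f, Finsupp.sum]
  exact Finset.sum_induction _ p add zero fun m hm => smul _ _
    (mon m (B.mem_of_coef_ne_zero (Finsupp.mem_support_iff.1 hm)))

/-- An element all of whose monomials belong to an ideal belongs to the ideal. -/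
theorem mem_of_forall_mon_mem {P : Ideal A} {f : A}
    (h : ∀ m, B.coef f m ≠ 0 → B.mon m ∈ P) : f ∈ P := by
  rw [B.eq_sum f]
  refine P.sum_mem fun m hm => ?_
  dsimp only
  rw [Algebra.smul_def]
  exact P.mul_mem_left _ (h m (Finsupp.mem_support_iff.1 hm))

theorem coef_mon_mul {m : M} (hm : m ∈ B.S) (f : A) (n : M) :
    B.coef (B.mon m * f) n = B.coef f (n - m) := by
  induction f using B.induction with
  | mon m' hm' =>
    rw [← B.mon_add hm hm', B.coef_mon (B.S.add_mem hm hm'), B.coef_mon hm']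
    classical
    rw [Finsupp.single_apply, Finsupp.single_apply]
    simp only [eq_sub_iff_add_eq, add_comm]
  | zero => simp
  | add f g hf hg => rw [mul_add, map_add, map_add, Finsupp.add_apply, Finsupp.add_apply, hf, hg]
  | smul c f hf =>
    rw [mul_smul_comm, map_smul, map_smul, Finsupp.smul_apply, Finsupp.smul_apply, hf]

/-- The linear map with given values on the monomials. -/
def lift {V : Type*} [AddCommGroup V] [Module K V] (g : M → V) : A →ₗ[K] V :=
  (Finsupp.linearCombination K g).comp B.coef

theorem lift_mon {V : Type*} [AddCommGroup V] [Module K V] (g : M → V) {m : M} (hm : m ∈ B.S) :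
    B.lift g (B.mon m) = g m := by
  rw [lift, LinearMap.comp_apply, B.coef_mon hm, Finsupp.linearCombination_single, one_smul]

theorem lift_mul {R : Type*} [CommRing R] [Algebra K R] {g : M → R}
    (hg : ∀ m ∈ B.S, ∀ m' ∈ B.S, g (m + m') = g m * g m') (x y : A) :
    B.lift g (x * y) = B.lift g x * B.lift g y := by
  induction x using B.induction with
  | mon m hm =>
    induction y using B.induction with
    | mon m' hm' =>
      rw [← B.mon_add hm hm', B.lift_mon _ hm, B.lift_mon _ hm',
        B.lift_mon _ (B.S.add_mem hm hm'), hg m hm m' hm']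
    | zero => simp
    | add f g hf hg => rw [mul_add, map_add, map_add, mul_add, hf, hg]
    | smul c f hf => rw [mul_smul_comm, map_smul, map_smul, mul_smul_comm, hf]
  | zero => simp
  | add f g hf hg => rw [add_mul, map_add, map_add, add_mul, hf, hg]
  | smul c f hf => rw [smul_mul_assoc, map_smul, map_smul, smul_mul_assoc, hf]

theorem derivation_ext {D E : Derivation K A A} (h : ∀ m ∈ B.S, D (B.mon m) = E (B.mon m)) :
    D = E := by
  ext f
  induction f using B.induction with
  | mon m hm => exact h m hm
  | zero => rw [map_zero, map_zero]
  | add f g hf hg => rw [map_add, map_add, hf, hg]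
  | smul c f hf => rw [D.map_smul, E.map_smul, hf]

/-! ### Faces and their prime ideals -/

/-- The projection of the coordinate algebra onto the span of the monomials in the face `d = 0`. -/
def faceHom (d : M → ℕ) (h0 : d 0 = 0)
    (hd : ∀ m ∈ B.S, ∀ m' ∈ B.S, d (m + m') = d m + d m') : A →ₐ[K] AddMonoidAlgebra K M :=
  AlgHom.ofLinearMap
    (B.lift fun m => if d m = 0 then AddMonoidAlgebra.single m (1 : K) else 0)
    (by rw [← B.mon_zero, B.lift_mon _ B.S.zero_mem, if_pos h0]; rfl)
    (B.lift_mul fun m hm m' hm' => by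
      rw [hd m hm m' hm']
      by_cases h : d m = 0 <;> by_cases h' : d m' = 0 <;>
        simp [h, h', AddMonoidAlgebra.single_mul_single])

theorem coeff_faceHom (d : M → ℕ) (h0 : d 0 = 0)
    (hd : ∀ m ∈ B.S, ∀ m' ∈ B.S, d (m + m') = d m + d m') (f : A) (m : M) :
    (B.faceHom d h0 hd f).coeff m = if d m = 0 then B.coef f m else 0 := by
  change AddMonoidAlgebra.coeff (B.lift (V := AddMonoidAlgebra K M) _ f) m = _
  induction f using B.induction with
  | mon m' hm' =>
    rw [B.lift_mon _ hm', B.coef_mon hm']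
    classical
    rcases eq_or_ne m' m with rfl | hne
    · split_ifs <;> simp
    · split_ifs <;> simp [hne]
  | zero => simp
  | add f g hf hg =>
    rw [map_add, map_add, AddMonoidAlgebra.coeff_add, Finsupp.add_apply, hf, hg]
    split_ifs <;> simp
  | smul c f hf =>
    rw [map_smul, map_smul, AddMonoidAlgebra.coeff_smul, Finsupp.smul_apply, hf]
    split_ifs <;> simp

end MonomialBasis

/-- `e` is a Demazure root for the nonnegative additive function `d` on the monoid `S`: adding `e`
lowers `d` by one and does not leave `S` except from the face `d = 0`. The function `d = 0` is
allowed. -/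
structure IsRoot {M : Type*} [AddCommGroup M] (S : AddSubmonoid M) (e : M) (d : M → ℕ) : Prop where
  add : ∀ m ∈ S, ∀ m' ∈ S, d (m + m') = d m + d m'
  shift : ∀ m ∈ S, 0 < d m → m + e ∈ S ∧ d (m + e) + 1 = d m

namespace IsRoot

variable {M : Type*} [AddCommGroup M] {S : AddSubmonoid M} {e : M} {d : M → ℕ}

theorem zero (h : IsRoot S e d) : d 0 = 0 := by
  have := h.add 0 S.zero_mem 0 S.zero_mem
  rw [add_zero] at this
  omega

theorem nsmul (h : IsRoot S e d) {m : M} (hm : m ∈ S) (k : ℕ) : d (k • m) = k * d m := by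
  induction k with
  | zero => rw [zero_smul, h.zero, zero_mul]
  | succ k ih => rw [succ_nsmul, h.add _ (S.nsmul_mem hm k) _ hm, ih, Nat.succ_mul]

theorem add_nsmul (h : IsRoot S e d) {m : M} (hm : m ∈ S) {k : ℕ} (hk : k ≤ d m) :
    m + k • e ∈ S ∧ d (m + k • e) + k = d m := by
  induction k with
  | zero => simpa using hm
  | succ k ih =>
    obtain ⟨h1, h2⟩ := ih (by omega)
    obtain ⟨h3, h4⟩ := h.shift _ h1 (by omega)
    rw [add_assoc, ← succ_nsmul] at h3 h4
    exact ⟨h3, by omega⟩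

theorem exists_eq_one (h : IsRoot S e d) {m : M} (hm : m ∈ S) (hd : 0 < d m) :
    ∃ m ∈ S, d m = 1 := by
  obtain ⟨h1, h2⟩ := h.add_nsmul hm (k := d m - 1) (by omega)
  exact ⟨_, h1, by omega⟩

/-- Shifting by a fixed vector changes `d` by a constant. -/
theorem add_vec (h : IsRoot S e d) {a b v : M} (ha : a ∈ S) (hb : b ∈ S) (hav : a + v ∈ S)
    (hbv : b + v ∈ S) : d (a + v) + d b = d (b + v) + d a := by
  rw [← h.add _ hav _ hb, ← h.add _ hbv _ ha]
  congr 1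
  abel

/-- A root determines `d` up to scaling by its face, hence determines it completely. -/
theorem eq_of_face_eq {e' : M} {d' : M → ℕ} (h : IsRoot S e d) (h' : IsRoot S e' d')
    (hdd : ∀ m ∈ S, d m = 0 ↔ d' m = 0) {m : M} (hm : m ∈ S) : d m = d' m := by
  rcases Nat.eq_zero_or_pos (d m) with h0 | hpos
  · rw [h0, (hdd m hm).1 h0]
  -- `d m₁ = 1` and `d' m₂ = 1` for some exponents. Up to elements of the common face,
  -- `m` agrees with `d m • m₁`.
  have key : ∀ {e e' : M} {d d' : M → ℕ}, IsRoot S e d → IsRoot S e' d' →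
      (∀ m ∈ S, d m = 0 ↔ d' m = 0) → ∀ m₁ ∈ S, d m₁ = 1 → ∀ m ∈ S,
        d' m = d m * d' m₁ := by
    intro e e' d d' h h' hdd m₁ hm₁ h1 m hm
    obtain ⟨h3, h4⟩ := h.add_nsmul hm le_rfl
    obtain ⟨h5, h6⟩ := h.add_nsmul hm₁ (k := 1) h1.ge
    rw [one_smul] at h5 h6
    have h7 : d' (m + d m • e) = 0 := (hdd _ h3).1 (by omega)
    have h8 : d' (m₁ + e) = 0 := (hdd _ h5).1 (by omega)
    have h9 : m + d m • (m₁ + e) = (m + d m • e) + d m • m₁ := by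
      rw [smul_add]; abel
    have h10 := congrArg d' h9
    rwa [h'.add _ hm _ (S.nsmul_mem h5 _), h'.add _ h3 _ (S.nsmul_mem hm₁ _), h'.nsmul h5,
      h'.nsmul hm₁, h7, h8, mul_zero, add_zero, zero_add] at h10
  obtain ⟨m₁, hm₁, h1⟩ := h.exists_eq_one hm hpos
  obtain ⟨m₂, hm₂, h2⟩ := h'.exists_eq_one hm
    (Nat.pos_of_ne_zero fun h0 => hpos.ne' ((hdd m hm).2 h0))
  have h3 := key h h' hdd m₁ hm₁ h1 m₂ hm₂
  rw [h2] at h3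
  have h4 : d' m₁ = 1 := Nat.eq_one_of_mul_eq_one_left h3.symm
  rw [key h h' hdd m₁ hm₁ h1 m hm, h4, mul_one]

end IsRoot

namespace MonomialBasis

variable {K A M : Type*} [Field K] [CommRing A] [Algebra K A] [AddCommGroup M]
  (B : MonomialBasis K A M) {e : M} {d : M → ℕ}

/-- The ideal spanned by the monomials with `d > 0`. -/
def faceIdeal (h : IsRoot B.S e d) : Ideal A := RingHom.ker (B.faceHom d h.zero h.add)

theorem mem_faceIdeal (h : IsRoot B.S e d) {f : A} :
    f ∈ B.faceIdeal h ↔ ∀ m, d m = 0 → B.coef f m = 0 := by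
  rw [faceIdeal, RingHom.mem_ker, ← AddMonoidAlgebra.coeff_inj, DFunLike.ext_iff]
  refine forall_congr' fun m => ?_
  erw [B.coeff_faceHom]
  simp

theorem mon_mem_faceIdeal (h : IsRoot B.S e d) {m : M} (hm : m ∈ B.S) :
    B.mon m ∈ B.faceIdeal h ↔ 0 < d m := by
  rw [mem_faceIdeal, B.coef_mon hm, Nat.pos_iff_ne_zero]
  classical
  constructor
  · intro h1 h2
    have := h1 m h2
    simp at this
  · rintro h1 m' h2
    rw [Finsupp.single_apply, if_neg]
    rintro rfl
    exact h1 h2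

instance isPrime_faceIdeal [UniqueSums M] (h : IsRoot B.S e d) : (B.faceIdeal h).IsPrime :=
  RingHom.ker_isPrime _

/-- A prime ideal that contains a monomial with `d > 0` but not its shift by the root contains the
whole face ideal: up to the shifted monomial, every monomial with `d = k > 0` is a multiple of the
`k`-th power of the given one. -/
theorem faceIdeal_le (h : IsRoot B.S e d) {Q : Ideal A} [hQ : Q.IsPrime] {m : M} (hm : m ∈ B.S)
    (hd : 0 < d m) (hmQ : B.mon m ∈ Q) (hmeQ : B.mon (m + e) ∉ Q) : B.faceIdeal h ≤ Q := by
  intro f hf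
  refine B.mem_of_forall_mon_mem fun m' hm' => ?_
  have hm'S := B.mem_of_coef_ne_zero hm'
  have hpos : 0 < d m' := Nat.pos_of_ne_zero fun h0 => hm' ((B.mem_faceIdeal h).1 hf m' h0)
  -- `mon m' * mon (m + e) ^ k` is divisible by `mon m`, where `k = d m'`.
  obtain ⟨h1, -⟩ := h.add_nsmul hm'S le_rfl
  obtain ⟨h2, -⟩ := h.shift m hm hd
  have hmon : ∀ {a : M} (_ : a ∈ B.S) (k : ℕ), B.mon (k • a) = B.mon a ^ k := by
    intro a ha k
    induction k with
    | zero => rw [zero_smul, B.mon_zero, pow_zero]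
    | succ k ih => rw [succ_nsmul, B.mon_add (B.S.nsmul_mem ha k) ha, ih, pow_succ]
  have h3 : B.mon m' * B.mon (m + e) ^ d m' = B.mon (m' + d m' • e) * B.mon m ^ d m' := by
    rw [← hmon h2, ← hmon hm, ← B.mon_add hm'S (B.S.nsmul_mem h2 _),
      ← B.mon_add h1 (B.S.nsmul_mem hm _)]
    congr 1
    rw [smul_add]
    abel
  have h4 : B.mon m' * B.mon (m + e) ^ d m' ∈ Q := by
    rw [h3]
    exact Q.mul_mem_left _ (Q.pow_mem_of_mem hmQ _ hpos)
  exact (hQ.mem_or_mem h4).resolve_right fun h5 => hmeQ (hQ.mem_of_pow_mem _ h5)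

/-- The prime ideal of a facet has height one, by Krull's principal ideal theorem: it is minimal
over any monomial with `d = 1`. -/
theorem height_faceIdeal [IsDomain A] [IsNoetherianRing A] [UniqueSums M] (h : IsRoot B.S e d)
    {m : M} (hm : m ∈ B.S) (hd : 0 < d m) : (B.faceIdeal h).height = 1 := by
  obtain ⟨m₁, hm₁, h1⟩ := h.exists_eq_one hm hd
  obtain ⟨h2, h3⟩ := h.shift m₁ hm₁ (by omega)
  have hmem : B.mon m₁ ∈ B.faceIdeal h := (B.mon_mem_faceIdeal h hm₁).2 (by omega)
  have hmin : B.faceIdeal h ∈ (Ideal.span {B.mon m₁}).minimalPrimes := by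
    refine ⟨⟨inferInstance, (Ideal.span_singleton_le_iff_mem _).2 hmem⟩, fun Q hQ hle => ?_⟩
    have := hQ.1
    refine B.faceIdeal_le h hm₁ (by omega) ((Ideal.span_singleton_le_iff_mem _).1 hQ.2)
      fun hQ' => ?_
    have := (B.mon_mem_faceIdeal h h2).1 (hle hQ')
    omega
  refine le_antisymm (Ideal.height_le_one_of_isPrincipal_of_mem_minimalPrimes _ _ hmin) ?_
  rw [Order.one_le_iff_ne_zero, Ne, Ideal.height_eq_zero_iff_eq_bot]
  intro hbot
  rw [hbot, Ideal.mem_bot] at hmem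
  exact B.mon_ne_zero hm₁ hmem

/-- The derivation `D` is homogeneous of degree `e`: it is the scalar `c` times the derivation of
the Demazure root `e`. -/
structure IsHomogeneous (D : Derivation K A A) (e : M) (c : K) (d : M → ℕ) : Prop where
  root : IsRoot B.S e d
  ne_zero : c ≠ 0
  apply_mon : ∀ m ∈ B.S, D (B.mon m) = (c * d m) • B.mon (m + e)

/-- The derivation attached to a Demazure root. -/
def rootDerivation (h : IsRoot B.S e d) : Derivation K A A :=
  Derivation.mk' (B.lift fun m => (d m : K) • B.mon (m + e)) fun f g => by
    induction f using B.induction with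
    | mon m hm =>
      induction g using B.induction with
      | mon m' hm' =>
        rw [← B.mon_add hm hm', B.lift_mon _ hm, B.lift_mon _ hm',
          B.lift_mon _ (B.S.add_mem hm hm'), h.add m hm m' hm', Nat.cast_add, add_smul, add_comm]
        simp only [smul_eq_mul, mul_smul_comm]
        congr 1
        · rcases Nat.eq_zero_or_pos (d m') with h0 | h0
          · simp [h0]
          · rw [add_assoc, B.mon_add hm (h.shift m' hm' h0).1]
        · rcases Nat.eq_zero_or_pos (d m) with h0 | h0
          · simp [h0]
          · rw [add_comm m, add_assoc, B.mon_add hm' (h.shift m hm h0).1]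
      | zero => simp
      | add f g hf hg =>
        rw [mul_add, map_add, map_add, hf, hg]
        simp only [smul_eq_mul]
        ring
      | smul c f hf =>
        rw [mul_smul_comm, map_smul, map_smul, hf]
        simp only [smul_eq_mul, Algebra.smul_def]
        ring
    | zero => simp
    | add f g hf hg =>
      rw [add_mul, map_add, map_add, hf, hg]
      simp only [smul_eq_mul]
      ring
    | smul c f hf =>
      rw [smul_mul_assoc, map_smul, map_smul, hf]
      simp only [smul_eq_mul, Algebra.smul_def]
      ring

theorem isHomogeneous_rootDerivation (h : IsRoot B.S e d) :
    B.IsHomogeneous (B.rootDerivation h) e 1 d where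
  root := h
  ne_zero := one_ne_zero
  apply_mon m hm := by
    rw [one_mul]
    exact B.lift_mon _ hm

end MonomialBasis

/-! ### Homogeneous locally nilpotent derivations -/

namespace MonomialBasis

section TorusAction

variable {K A M T : Type*} [Field K] [CommRing A] [Algebra K A] [AddCommGroup M] [Group T]
  (B : MonomialBasis K A M)

/-- The group `T` acts on the monomials through pairwise distinct characters, multiplicative in the
exponent. -/
structure IsTorusAction (χ : M → T →* K) (τ : T →* (A ≃ₐ[K] A)) : Prop where
  injective : Function.Injective χ
  map_add : ∀ m m', χ (m + m') = χ m * χ m'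
  apply_mon : ∀ t, ∀ m ∈ B.S, τ t (B.mon m) = χ m t • B.mon m

variable {B} {χ : M → T →* K} {τ : T →* (A ≃ₐ[K] A)}

theorem IsTorusAction.coef_apply (hτ : B.IsTorusAction χ τ) (t : T) (f : A) (n : M) :
    B.coef (τ t f) n = χ n t * B.coef f n := by
  induction f using B.induction with
  | mon m hm =>
    rw [hτ.apply_mon t m hm, map_smul, B.coef_mon hm, Finsupp.smul_apply, smul_eq_mul]
    classical
    rw [Finsupp.single_apply]
    split_ifs with h
    · rw [h]
    · rw [mul_zero, mul_zero]
  | zero => simp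
  | add f g hf hg => rw [_root_.map_add, _root_.map_add, _root_.map_add, Finsupp.add_apply, hf, hg,
      Finsupp.add_apply, mul_add]
  | smul c f hf => rw [map_smul, map_smul, map_smul, Finsupp.smul_apply, hf, Finsupp.smul_apply,
      smul_eq_mul, smul_eq_mul, mul_left_comm]

/-- Prime ideals stable under the torus are spanned by monomials. -/
theorem IsTorusAction.mon_mem (hτ : B.IsTorusAction χ τ) {P : Ideal A} [P.IsPrime]
    (hP : ∀ t, ∀ f ∈ P, τ t f ∈ P) {f : A} (hf : f ∈ P) {m : M} (hm : B.coef f m ≠ 0) :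
    B.mon m ∈ P := by
  -- The characters of the torus are linearly independent over the domain `A / P`.
  let ψ : M → T →* (A ⧸ P) := fun m => ((algebraMap K (A ⧸ P)) : K →* (A ⧸ P)).comp (χ m)
  have hψ : Function.Injective ψ := by
    intro m m' h
    apply hτ.injective
    ext t
    exact FaithfulSMul.algebraMap_injective K (A ⧸ P) (DFunLike.congr_fun h t)
  have hli := (linearIndependent_monoidHom T (A ⧸ P)).comp ψ hψ
  have h0 : ∑ m ∈ (B.coef f).support,
      Ideal.Quotient.mk P (B.coef f m • B.mon m) • (fun t => ψ m t) = 0 := by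
    funext t
    rw [Finset.sum_apply, Pi.zero_apply, ← Ideal.Quotient.eq_zero_iff_mem.2 (hP t f hf)]
    conv_rhs => rw [B.eq_sum f, Finsupp.sum, _root_.map_sum, _root_.map_sum]
    refine Finset.sum_congr rfl fun m hm => ?_
    rw [map_smul (τ t), hτ.apply_mon t m (B.mem_of_coef_ne_zero (Finsupp.mem_support_iff.1 hm)),
      smul_comm, Pi.smul_apply, smul_eq_mul, Algebra.smul_def (χ m t), map_mul, mul_comm]
    rfl
  have h1 := linearIndependent_iff'.1 hli _ _ h0 m (Finsupp.mem_support_iff.2 hm)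
  rw [Ideal.Quotient.eq_zero_iff_mem] at h1
  have h2 := P.mul_mem_left (algebraMap K A (B.coef f m)⁻¹) h1
  rwa [← Algebra.smul_def, smul_smul, inv_mul_cancel₀ hm, one_smul] at h2

/-- If the torus scales a nonzero derivation by a function `r`, then `r` is the character of some
exponent. -/
theorem IsTorusAction.exists_degree (hτ : B.IsTorusAction χ τ) {D : Derivation K A A} (hD : D ≠ 0)
    {r : T → K} (hr : ∀ t f, τ t (D f) = r t • D (τ t f)) : ∃ e, ∀ t, r t = χ e t := by
  obtain ⟨m, hm, hDm⟩ : ∃ m ∈ B.S, D (B.mon m) ≠ 0 := by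
    by_contra! h
    exact hD (B.derivation_ext h)
  obtain ⟨n, hn⟩ : ∃ n, B.coef (D (B.mon m)) n ≠ 0 := by
    by_contra! h
    exact hDm (B.coef_injective ((Finsupp.ext h).trans (_root_.map_zero _).symm))
  refine ⟨n - m, fun t => ?_⟩
  have h1 := congrArg (fun f => B.coef f n) (hr t (B.mon m))
  rw [hτ.coef_apply, hτ.apply_mon t m hm, D.map_smul, smul_smul, map_smul, Finsupp.smul_apply,
    smul_eq_mul] at h1
  have h2 : χ n t = χ (n - m) t * χ m t := by
    rw [← MonoidHom.mul_apply, ← hτ.map_add, sub_add_cancel]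
  have h3 : χ m t ≠ 0 := ((Group.isUnit t).map (χ m)).ne_zero
  exact mul_right_cancel₀ h3 ((mul_right_cancel₀ hn h1).symm.trans h2)

/-- A locally nilpotent derivation of degree `e` is given by a Demazure root. -/
theorem IsTorusAction.exists_isHomogeneous [CharZero K] (hτ : B.IsTorusAction χ τ)
    {D : Derivation K A A} (hnil : ∀ f, ∃ N, (D^[N]) f = 0) {e : M}
    (he : ∀ t f, τ t (D f) = χ e t • D (τ t f)) : ∃ c d, B.IsHomogeneous D e c d := by
  let c : M → K := fun m => B.coef (D (B.mon m)) (m + e)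
  have happly : ∀ m ∈ B.S, D (B.mon m) = c m • B.mon (m + e) ∧ (c m ≠ 0 → m + e ∈ B.S) := by
    intro m hm
    have hsupp : ∀ n, B.coef (D (B.mon m)) n ≠ 0 → n = m + e := by
      intro n hn
      apply hτ.injective
      ext t
      have h1 := congrArg (fun f => B.coef f n) (he t (B.mon m))
      rw [hτ.coef_apply, hτ.apply_mon t m hm, D.map_smul, smul_smul, map_smul, Finsupp.smul_apply,
        smul_eq_mul] at h1
      rw [mul_right_cancel₀ hn h1, ← MonoidHom.mul_apply, ← hτ.map_add, add_comm]
    have hmem : c m ≠ 0 → m + e ∈ B.S := fun h => B.mem_of_coef_ne_zero h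
    refine ⟨?_, hmem⟩
    apply B.coef_injective
    rw [map_smul]
    ext n
    by_cases hc : c m = 0
    · rw [hc, zero_smul, Finsupp.zero_apply]
      by_contra hn
      obtain rfl := hsupp n hn
      exact hn hc
    · rw [B.coef_mon (hmem hc), Finsupp.smul_single, smul_eq_mul, mul_one]
      classical
      rw [Finsupp.single_apply]
      split_ifs with hn
      · rw [← hn]
      · by_contra h
        exact hn (hsupp n h).symm
  have hadd : ∀ m ∈ B.S, ∀ m' ∈ B.S, c (m + m') = c m + c m' := by
    intro m hm m' hm'
    change B.coef (D (B.mon (m + m'))) (m + m' + e) = _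
    rw [B.mon_add hm hm', D.leibniz, smul_eq_mul, smul_eq_mul, _root_.map_add B.coef,
      Finsupp.add_apply,
      B.coef_mon_mul hm, B.coef_mon_mul hm', add_comm (c m)]
    congr 3 <;> abel
  by_cases h0 : ∀ m ∈ B.S, c m = 0
  · refine ⟨1, fun _ => 0, ⟨fun _ _ _ _ => rfl, fun _ _ h => absurd h (lt_irrefl _)⟩, one_ne_zero,
      fun m hm => ?_⟩
    rw [(happly m hm).1, h0 m hm, Nat.cast_zero, mul_zero]
  push Not at h0
  obtain ⟨m₀, hm₀, hc₀⟩ := h0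
  have hm₀e := (happly m₀ hm₀).2 hc₀
  -- The additive function `c` increases by the constant `k` under the shift by `e`; since it
  -- reaches zero in finitely many steps, its values are natural multiples of `-k`.
  obtain ⟨k, hk⟩ : ∃ k, ∀ m ∈ B.S, m + e ∈ B.S → c (m + e) = c m + k := by
    refine ⟨c (m₀ + e) - c m₀, fun m hm hme => ?_⟩
    have h1 := hadd _ hme _ hm₀
    rw [show m + e + m₀ = (m₀ + e) + m by abel, hadd _ hm₀e _ hm] at h1
    linear_combination -h1
  have hN : ∀ N, ∀ m ∈ B.S, (D^[N]) (B.mon m) = 0 → ∃ j : ℕ, c m = -k * j := by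
    intro N
    induction N with
    | zero => exact fun m hm h => absurd h (B.mon_ne_zero hm)
    | succ N ih =>
      intro m hm h
      by_cases hc : c m = 0
      · exact ⟨0, by simp [hc]⟩
      · have hme := (happly m hm).2 hc
        rw [Function.iterate_succ_apply, (happly m hm).1, derivation_iterate_smul,
          smul_eq_zero_iff_right hc] at h
        obtain ⟨j, hj⟩ := ih _ hme h
        rw [hk m hm hme] at hj
        refine ⟨j + 1, ?_⟩
        push_cast
        linear_combination hj
  have hex : ∀ m, ∃ j : ℕ, m ∈ B.S → c m = -k * j := by
    intro m
    by_cases hm : m ∈ B.S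
    · obtain ⟨N, hN'⟩ := hnil (B.mon m)
      obtain ⟨j, hj⟩ := hN N m hm hN'
      exact ⟨j, fun _ => hj⟩
    · exact ⟨0, fun h => absurd h hm⟩
  choose d hd using hex
  have hk0 : -k ≠ 0 := by
    intro h
    have := hd m₀ hm₀
    rw [h, zero_mul] at this
    exact hc₀ this
  refine ⟨-k, d, ⟨fun m hm m' hm' => ?_, fun m hm hpos => ?_⟩, hk0, fun m hm => ?_⟩
  · have h1 := hadd m hm m' hm'
    rw [hd _ (B.S.add_mem hm hm'), hd _ hm, hd _ hm', ← mul_add] at h1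
    exact_mod_cast mul_left_cancel₀ hk0 h1
  · have hc : c m ≠ 0 := by
      rw [hd m hm]
      exact mul_ne_zero hk0 (by exact_mod_cast hpos.ne')
    have hme := (happly m hm).2 hc
    refine ⟨hme, ?_⟩
    have h1 := hk m hm hme
    rw [hd _ hme, hd _ hm] at h1
    have h2 : -k * ((d (m + e) : K) + 1) = -k * d m := by linear_combination h1
    exact_mod_cast mul_left_cancel₀ hk0 h2
  · rw [(happly m hm).1, hd m hm]

end TorusAction

section Commuting

variable {K A M : Type*} [Field K] [CharZero K] [CommRing A] [Algebra K A]
  [AddCommGroup M] {B : MonomialBasis K A M} {D E : Derivation K A A} {e a : M} {c r : K}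
  {d p : M → ℕ}

theorem IsHomogeneous.apply_mon_eq_zero_iff (h : B.IsHomogeneous D e c d) {m : M} (hm : m ∈ B.S) :
    D (B.mon m) = 0 ↔ d m = 0 := by
  rw [h.apply_mon m hm]
  constructor
  · intro h0
    by_contra hd
    rw [smul_eq_zero_iff_right (mul_ne_zero h.ne_zero (by exact_mod_cast hd))] at h0
    exact B.mon_ne_zero (h.root.shift m hm (Nat.pos_of_ne_zero hd)).1 h0
  · intro h0
    rw [h0, Nat.cast_zero, mul_zero, zero_smul]

theorem IsHomogeneous.eq_zero_iff (h : B.IsHomogeneous D e c d) :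
    D = 0 ↔ ∀ m ∈ B.S, d m = 0 := by
  constructor
  · rintro rfl m hm
    exact (h.apply_mon_eq_zero_iff hm).1 rfl
  · intro h0
    exact B.derivation_ext fun m hm => (h.apply_mon_eq_zero_iff hm).2 (h0 m hm)

theorem IsHomogeneous.coef_apply (h : B.IsHomogeneous D e c d) (f : A) (m : M) :
    B.coef (D f) (m + e) = c * d m * B.coef f m := by
  induction f using B.induction with
  | mon m' hm' =>
    rw [h.apply_mon m' hm', map_smul, Finsupp.smul_apply, B.coef_mon hm', smul_eq_mul]
    classical
    rcases Nat.eq_zero_or_pos (d m') with h0 | h0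
    · rw [h0, Finsupp.single_apply]
      split_ifs with hmm
      · rw [← hmm, h0]
        simp
      · simp
    · rw [B.coef_mon (h.root.shift m' hm' h0).1, Finsupp.single_apply, Finsupp.single_apply]
      by_cases hmm : m' = m
      · rw [hmm]
        simp
      · rw [if_neg hmm, if_neg fun h => hmm (add_right_cancel h)]
        simp
  | zero => simp
  | add f g hf hg => rw [map_add D, map_add B.coef, Finsupp.add_apply, hf, hg, map_add B.coef,
      Finsupp.add_apply,
      mul_add]
  | smul k f hf => rw [D.map_smul, map_smul, Finsupp.smul_apply, hf, map_smul, Finsupp.smul_apply,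
      smul_eq_mul, smul_eq_mul, mul_left_comm]

/-- The kernel of a homogeneous derivation is spanned by the monomials in its face. -/
theorem IsHomogeneous.eq_zero_of_apply_eq_zero (h : B.IsHomogeneous D e c d) {f : A}
    (hf : D f = 0) {m : M} (hm : B.coef f m ≠ 0) : d m = 0 := by
  have h1 := h.coef_apply f m
  rw [hf, map_zero, Finsupp.zero_apply, eq_comm, mul_eq_zero, mul_eq_zero] at h1
  exact_mod_cast (h1.resolve_right hm).resolve_left h.ne_zero

theorem IsHomogeneous.apply_eq_zero (h : B.IsHomogeneous D e c d) {f : A}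
    (hf : ∀ m, B.coef f m ≠ 0 → d m = 0) : D f = 0 := by
  rw [B.eq_sum f, Finsupp.sum, map_sum]
  refine Finset.sum_eq_zero fun m hm => ?_
  have hm' := Finsupp.mem_support_iff.1 hm
  rw [D.map_smul, (h.apply_mon_eq_zero_iff (B.mem_of_coef_ne_zero hm')).2 (hf m hm'), smul_zero]

/-- The derivation of a Demazure root is locally nilpotent: it lowers `d`. -/
theorem IsHomogeneous.exists_iterate_eq_zero (h : B.IsHomogeneous D e c d) (f : A) :
    ∃ N, (D^[N]) f = 0 := by
  induction f using B.induction with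
  | mon m hm =>
    have : ∀ k, ∀ m ∈ B.S, d m = k → (D^[k + 1]) (B.mon m) = 0 := by
      intro k
      induction k with
      | zero => exact fun m hm hd => (h.apply_mon_eq_zero_iff hm).2 hd
      | succ k ih =>
        intro m hm hd
        obtain ⟨h1, h2⟩ := h.root.shift m hm (by omega)
        rw [Function.iterate_succ_apply, h.apply_mon m hm, derivation_iterate_smul,
          ih _ h1 (by omega), smul_zero]
    exact ⟨_, this _ m hm rfl⟩
  | zero => exact ⟨0, rfl⟩
  | add f g hf hg =>
    obtain ⟨N, hN⟩ := hf
    obtain ⟨N', hN'⟩ := hg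
    refine ⟨N + N', ?_⟩
    rw [iterate_map_add, Nat.add_comm, Function.iterate_add_apply, hN, Nat.add_comm,
      Function.iterate_add_apply, hN', iterate_map_zero, iterate_map_zero, add_zero]
  | smul k f hf =>
    obtain ⟨N, hN⟩ := hf
    exact ⟨N, by rw [derivation_iterate_smul, hN, smul_zero]⟩
/-- A monomial ideal is stable under a homogeneous derivation if and only if it is so on
monomials. -/
theorem IsHomogeneous.stable_of_mon (h : B.IsHomogeneous D e c d) {P : Ideal A}
    (hP : ∀ f ∈ P, ∀ m, B.coef f m ≠ 0 → B.mon m ∈ P)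
    (hmon : ∀ m ∈ B.S, B.mon m ∈ P → 0 < d m → B.mon (m + e) ∈ P) : ∀ f ∈ P, D f ∈ P := by
  intro f hf
  rw [B.eq_sum f, Finsupp.sum, map_sum]
  refine P.sum_mem fun m hm => ?_
  have hm' := Finsupp.mem_support_iff.1 hm
  have hmS := B.mem_of_coef_ne_zero hm'
  rw [D.map_smul, h.apply_mon m hmS, smul_smul, Algebra.smul_def]
  rcases Nat.eq_zero_or_pos (d m) with h0 | h0
  · simp [h0]
  · exact P.mul_mem_left _ (hmon m hmS (hP f hf m hm') h0)

theorem IsHomogeneous.mon_add_mem (h : B.IsHomogeneous D e c d) {P : Ideal A}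
    (hP : ∀ f ∈ P, D f ∈ P) {m : M} (hm : m ∈ B.S) (hmP : B.mon m ∈ P) (hd : 0 < d m) :
    B.mon (m + e) ∈ P := by
  have h1 := hP _ hmP
  rw [h.apply_mon m hm] at h1
  have h0 : c * (d m : K) ≠ 0 := mul_ne_zero h.ne_zero (by exact_mod_cast hd.ne')
  have h2 := P.mul_mem_left (algebraMap K A (c * d m)⁻¹) h1
  rwa [← Algebra.smul_def, smul_smul, inv_mul_cancel₀ h0, one_smul] at h2

/-- The face ideal of a nonzero homogeneous derivation is not stable under it. -/
theorem IsHomogeneous.not_stable_faceIdeal (h : B.IsHomogeneous D e c d) (hD : D ≠ 0) :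
    ¬ ∀ f ∈ B.faceIdeal h.root, D f ∈ B.faceIdeal h.root := by
  intro hs
  rw [Ne, h.eq_zero_iff] at hD
  push Not at hD
  obtain ⟨m, hm, hd⟩ := hD
  obtain ⟨m₁, hm₁, h1⟩ := h.root.exists_eq_one hm (Nat.pos_of_ne_zero hd)
  obtain ⟨h2, h3⟩ := h.root.shift m₁ hm₁ (by omega)
  have := h.mon_add_mem hs hm₁ ((B.mon_mem_faceIdeal h.root hm₁).2 (by omega)) (by omega)
  rw [B.mon_mem_faceIdeal h.root h2] at this
  omega

/-- If two homogeneous derivations commute and the first does not vanish on the kernel of the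
second, then each degree is annihilated by the valuation of the other derivation. -/
theorem IsHomogeneous.shift_eq_of_commute (hD : B.IsHomogeneous D e c d)
    (hE : B.IsHomogeneous E a r p) (hcomm : ∀ f, D (E f) = E (D f)) {m₀ : M} (hm₀ : m₀ ∈ B.S)
    (hp₀ : p m₀ = 0) (hd₀ : 0 < d m₀) {m₁ : M} (hm₁ : m₁ ∈ B.S) (hp₁ : 0 < p m₁) :
    (∀ m ∈ B.S, m + a ∈ B.S → d (m + a) = d m) ∧
      ∀ m ∈ B.S, m + e ∈ B.S → p (m + e) = p m := by
  obtain ⟨h0e, -⟩ := hD.root.shift m₀ hm₀ hd₀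
  have hp0e : p (m₀ + e) = 0 := by
    have h1 := hcomm (B.mon m₀)
    rw [(hE.apply_mon_eq_zero_iff hm₀).2 hp₀, map_zero, hD.apply_mon m₀ hm₀, E.map_smul, eq_comm,
      smul_eq_zero_iff_right (mul_ne_zero hD.ne_zero (by exact_mod_cast hd₀.ne')),
      hE.apply_mon_eq_zero_iff h0e] at h1
    exact h1
  have hpe : ∀ m ∈ B.S, m + e ∈ B.S → p (m + e) = p m := by
    intro m hm hme
    have := hE.root.add_vec hm hm₀ hme h0e
    omega
  refine ⟨?_, hpe⟩
  have h2S := B.S.add_mem hm₀ hm₁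
  have hd2 := hD.root.add _ hm₀ _ hm₁
  have hp2 := hE.root.add _ hm₀ _ hm₁
  obtain ⟨h2a, -⟩ := hE.root.shift _ h2S (by omega)
  obtain ⟨h2e, -⟩ := hD.root.shift _ h2S (by omega)
  have hp2e := hpe _ h2S h2e
  obtain ⟨h2ea, -⟩ := hE.root.shift _ h2e (by omega)
  have hda : d (m₀ + m₁ + a) = d (m₀ + m₁) := by
    have h1 := hcomm (B.mon (m₀ + m₁))
    rw [hE.apply_mon _ h2S, D.map_smul, hD.apply_mon _ h2a, hD.apply_mon _ h2S, E.map_smul,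
      hE.apply_mon _ h2e, hp2e,
      add_right_comm _ a e, smul_smul, smul_smul] at h1
    have h3 := congrArg (fun f => B.coef f (m₀ + m₁ + e + a)) h1
    simp only [map_smul, Finsupp.smul_apply, B.coef_mon h2ea, Finsupp.single_eq_same,
      smul_eq_mul, mul_one] at h3
    have h4 : r * p (m₀ + m₁) * c ≠ 0 :=
      mul_ne_zero (mul_ne_zero hE.ne_zero (by exact_mod_cast (by omega))) hD.ne_zero
    have h5 : r * p (m₀ + m₁) * c * d (m₀ + m₁ + a) = r * p (m₀ + m₁) * c * d (m₀ + m₁) := by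
      linear_combination h3
    exact_mod_cast mul_left_cancel₀ h4 h5
  intro m hm hma
  have := hD.root.add_vec hm h2S hma h2a
  omega

theorem IsHomogeneous.commute_of_shift_eq (hD : B.IsHomogeneous D e c d)
    (hE : B.IsHomogeneous E a r p) (hd : ∀ m ∈ B.S, m + a ∈ B.S → d (m + a) = d m)
    (hp : ∀ m ∈ B.S, m + e ∈ B.S → p (m + e) = p m) (f : A) : D (E f) = E (D f) := by
  induction f using B.induction with
  | mon m hm =>
    rcases Nat.eq_zero_or_pos (p m) with hp0 | hp0
    · rw [(hE.apply_mon_eq_zero_iff hm).2 hp0, map_zero, hD.apply_mon m hm, E.map_smul]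
      rcases Nat.eq_zero_or_pos (d m) with hd0 | hd0
      · rw [hd0, Nat.cast_zero, mul_zero, zero_smul]
      · have hme := (hD.root.shift m hm hd0).1
        rw [(hE.apply_mon_eq_zero_iff hme).2 ((hp m hm hme).trans hp0), smul_zero]
    · have hma := (hE.root.shift m hm hp0).1
      rw [hE.apply_mon m hm, D.map_smul]
      rcases Nat.eq_zero_or_pos (d m) with hd0 | hd0
      · rw [(hD.apply_mon_eq_zero_iff hm).2 hd0, map_zero,
          (hD.apply_mon_eq_zero_iff hma).2 ((hd m hm hma).trans hd0), smul_zero]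
      · have hme := (hD.root.shift m hm hd0).1
        rw [hD.apply_mon _ hma, hD.apply_mon _ hm, E.map_smul, hE.apply_mon _ hme, hd m hm hma,
          hp m hm hme, smul_smul, smul_smul, add_right_comm, mul_comm]
  | zero => simp
  | add f g hf hg => rw [map_add, map_add, map_add, map_add, hf, hg]
  | smul k f hf => rw [E.map_smul, D.map_smul, D.map_smul, E.map_smul, hf]

/-- If an element of an additive group with generator of degree `a ≠ 0` rescales a nonzero
homogeneous derivation, then it commutes with it: the action does not change the coefficient of
the leading monomial. -/
theorem IsHomogeneous.scale_eq_one [IsDomain A] {σ : Multiplicative K →* (A ≃ₐ[K] A)}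
    (hD : B.IsHomogeneous D e c d) (hD0 : D ≠ 0) (hE : B.IsHomogeneous E a r p)
    (hσ : IsFlow σ E) (ha : ∀ k : ℕ, k ≠ 0 → k • a ≠ 0) {s : Multiplicative K} {l : K}
    (h : ∀ f, σ s (D f) = l • D (σ s f)) : l = 1 := by
  have hiter : ∀ n ∈ B.S, ∀ k, ∃ x : K, (E^[k]) (B.mon n) = x • B.mon (n + k • a) ∧
      (x ≠ 0 → n + k • a ∈ B.S) := by
    intro n hn k
    induction k with
    | zero => exact ⟨1, by simp, by simpa using hn⟩
    | succ k ih =>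
      obtain ⟨x, hx, hxS⟩ := ih
      rw [Function.iterate_succ_apply', hx, E.map_smul]
      by_cases hx0 : x = 0
      · exact ⟨0, by simp [hx0], fun h => absurd rfl h⟩
      · refine ⟨x * (r * p (n + k • a)), ?_, fun hne => ?_⟩
        · rw [hE.apply_mon _ (hxS hx0), smul_smul, succ_nsmul, add_assoc]
        · rw [succ_nsmul, ← add_assoc]
          refine (hE.root.shift _ (hxS hx0) (Nat.pos_of_ne_zero fun h0 => hne ?_)).1
          rw [h0, Nat.cast_zero, mul_zero, mul_zero]
  have hcoef : ∀ n ∈ B.S, B.coef (σ s (B.mon n)) n = 1 := by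
    intro n hn
    obtain ⟨P, hP, hPs⟩ := hσ (B.mon n)
    obtain ⟨q, hq, hqs⟩ := exists_polynomial_map_coeff ((Finsupp.lapply n).comp B.coef) P
    have : q = Polynomial.C 1 := by
      ext k
      rw [hq, hP, map_smul, LinearMap.comp_apply, Finsupp.lapply_apply, Polynomial.coeff_C]
      split_ifs with hk
      · subst hk
        simp [B.coef_mon hn]
      · obtain ⟨x, hx, hxS⟩ := hiter n hn k
        rw [hx, map_smul, Finsupp.smul_apply]
        classical
        by_cases hx0 : x = 0
        · simp [hx0]
        · rw [B.coef_mon (hxS hx0), Finsupp.single_apply, if_neg, smul_zero, smul_zero]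
          intro h
          exact ha k hk (by simpa using h)
    have h1 := hqs s.toAdd
    rw [this, Polynomial.eval_C, ← hPs] at h1
    exact h1.symm
  rw [Ne, hD.eq_zero_iff] at hD0
  push Not at hD0
  obtain ⟨m, hm, hd⟩ := hD0
  have h1 := congrArg (fun f => B.coef f (m + e)) (h (B.mon m))
  have h0 : c * (d m : K) ≠ 0 := mul_ne_zero hD.ne_zero (by exact_mod_cast hd)
  rw [map_smul, Finsupp.smul_apply, hD.coef_apply, hD.apply_mon m hm, map_smul, map_smul,
    Finsupp.smul_apply, hcoef _ hm, hcoef _ (hD.root.shift m hm (Nat.pos_of_ne_zero hd)).1,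
    smul_eq_mul, smul_eq_mul, mul_one] at h1
  exact (mul_right_cancel₀ h0 ((one_mul _).trans h1)).symm

end Commuting

end MonomialBasis

/-! ### Existence of Demazure roots -/

/-- The local ring of a normal variety at a prime divisor is a discrete valuation ring. -/
theorem isDiscreteValuationRing_of_height_eq_one {A : Type*} [CommRing A] [IsDomain A]
    [IsNoetherianRing A] [IsIntegrallyClosed A] (Q : Ideal A) [Q.IsPrime] (hQ : Q.height = 1) :
    IsDiscreteValuationRing (Localization.AtPrime Q) := by
  let R := Localization.AtPrime Q
  have hle := Q.primeCompl_le_nonZeroDivisors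
  have : IsDomain R := IsLocalization.isDomain_localization hle
  have : IsNoetherianRing R := IsLocalization.isNoetherianRing Q.primeCompl R inferInstance
  have : IsIntegrallyClosed R := isIntegrallyClosed_of_isLocalization R Q.primeCompl hle
  have hmax : Q.map (algebraMap A R) = IsLocalRing.maximalIdeal R :=
    Localization.AtPrime.map_eq_maximalIdeal
  have huniq : ∀ P : Ideal R, P ≠ ⊥ → P.IsPrime → P = IsLocalRing.maximalIdeal R := by
    intro P hP hPp
    have h1 := (IsLocalization.isPrime_iff_isPrime_disjoint Q.primeCompl R P).1 hPp
    have := h1.1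
    have h2 : P.under A ≤ Q := fun x hx => by
      by_contra hxQ
      exact Set.disjoint_left.1 h1.2 hxQ hx
    have h3 : P.under A ≠ ⊥ := by
      intro h
      apply hP
      rw [← IsLocalization.map_under Q.primeCompl R P, h, Ideal.map_bot]
    rw [← IsLocalization.map_under Q.primeCompl R P, eq_of_le_of_height_eq_one hQ h3 h2, hmax]
  have htfae : IsPrincipalIdealRing R ↔ IsIntegrallyClosed R ∧ ∀ P : Ideal R, P ≠ ⊥ → P.IsPrime →
      P = IsLocalRing.maximalIdeal R :=
    (tfae_of_isNoetherianRing_of_isLocalRing_of_isDomain R).out 0 3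
  have hpid : IsPrincipalIdealRing R := htfae.2 ⟨inferInstance, huniq⟩
  refine { hpid with not_a_field' := ?_, toIsLocalRing := inferInstance }
  rw [← hmax]
  intro h
  apply Ideal.ne_bot_of_height_eq_one hQ
  rw [eq_bot_iff]
  intro x hx
  have h1 := Ideal.mem_map_of_mem (algebraMap A R) hx
  rw [h, Ideal.mem_bot] at h1
  exact IsLocalization.injective R hle (h1.trans (map_zero _).symm)

namespace MonomialBasis

variable {K A M : Type*} [Field K] [CommRing A] [IsDomain A] [Algebra K A] [AddCommGroup M]
  (B : MonomialBasis K A M)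

/-- Every monomial prime ideal of height one in a normal Noetherian domain has a Demazure root, for
the valuation `d` of the local ring at the prime. With a monomial `mon m₁` of valuation one and an
element `b` outside the prime such that `b` carries the prime into the multiples of `mon m₁`, the
root is the quotient of a monomial of `b` by `mon m₁`. -/
theorem exists_isRoot [IsNoetherianRing A] [IsIntegrallyClosed A] (Q : Ideal A) [hQp : Q.IsPrime]
    (hQ : Q.height = 1) (hmon : ∀ f ∈ Q, ∀ m, B.coef f m ≠ 0 → B.mon m ∈ Q) :
    ∃ e d, IsRoot B.S e d ∧ ∀ m ∈ B.S, 0 < d m ↔ B.mon m ∈ Q := by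
  let R := Localization.AtPrime Q
  have hle := Q.primeCompl_le_nonZeroDivisors
  have : IsDomain R := IsLocalization.isDomain_localization hle
  have : IsDiscreteValuationRing R := isDiscreteValuationRing_of_height_eq_one Q hQ
  have hmax : Q.map (algebraMap A R) = IsLocalRing.maximalIdeal R :=
    Localization.AtPrime.map_eq_maximalIdeal
  have hinj : Function.Injective (algebraMap A R) := IsLocalization.injective R hle
  let v := IsDiscreteValuationRing.addVal R
  have hunit : ∀ f, v (algebraMap A R f) = 0 ↔ f ∉ Q := fun f =>
    IsDiscreteValuationRing.addVal_eq_zero_iff.trans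
      (IsLocalization.AtPrime.isUnit_to_map_iff R Q f)
  let d : M → ℕ := fun m => (v (algebraMap A R (B.mon m))).toNat
  have hd : ∀ m ∈ B.S, (d m : ℕ∞) = v (algebraMap A R (B.mon m)) := by
    intro m hm
    refine ENat.natCast_toNat ?_
    rw [Ne, IsDiscreteValuationRing.addVal_eq_top_iff]
    intro h
    exact B.mon_ne_zero hm (hinj (h.trans (map_zero _).symm))
  have hpos : ∀ m ∈ B.S, 0 < d m ↔ B.mon m ∈ Q := by
    intro m hm
    rw [Nat.pos_iff_ne_zero, ← not_iff_not, not_not, ← hunit, ← hd m hm, Nat.cast_eq_zero]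
  have hadd : ∀ m ∈ B.S, ∀ m' ∈ B.S, d (m + m') = d m + d m' := by
    intro m hm m' hm'
    have h1 : (d (m + m') : ℕ∞) = d m + d m' := by
      rw [hd _ (B.S.add_mem hm hm'), hd m hm, hd m' hm', B.mon_add hm hm', map_mul]
      exact IsDiscreteValuationRing.addVal_mul
    exact_mod_cast h1
  -- Some monomial is a uniformizer, since the monomials in `Q` generate the maximal ideal.
  obtain ⟨m₁, hm₁, hd₁⟩ : ∃ m ∈ B.S, d m = 1 := by
    by_contra! hne
    obtain ⟨ϖ, hϖ⟩ := IsDiscreteValuationRing.exists_irreducible R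
    have hϖmem : ϖ ∈ Q.map (algebraMap A R) := by
      rw [hmax, hϖ.maximalIdeal_eq]
      exact Ideal.mem_span_singleton_self ϖ
    have hsub : Q.map (algebraMap A R) ≤ Ideal.span {ϖ ^ 2} := by
      rw [Ideal.map_le_iff_le_comap]
      intro f hf
      refine B.mem_of_forall_mon_mem fun m hm => ?_
      have hmS := B.mem_of_coef_ne_zero hm
      rw [Ideal.mem_comap, Ideal.mem_span_singleton, ← IsDiscreteValuationRing.addVal_le_iff_dvd,
        hϖ.addVal_pow]
      change _ ≤ v _
      rw [← hd m hmS]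
      have h1 := (hpos m hmS).2 (hmon f hf m hm)
      have h2 := hne m hmS
      exact_mod_cast (by omega : 2 ≤ d m)
    have h1 := Ideal.mem_span_singleton.1 (hsub hϖmem)
    rw [← IsDiscreteValuationRing.addVal_le_iff_dvd, hϖ.addVal_pow,
      IsDiscreteValuationRing.addVal_uniformizer hϖ] at h1
    exact absurd h1 (by decide)
  have hdvd : ∀ g ∈ Q, ∃ b ∉ Q, B.mon m₁ ∣ b * g := by
    intro g hg
    have h1 : algebraMap A R (B.mon m₁) ∣ algebraMap A R g := by
      rw [← IsDiscreteValuationRing.addVal_le_iff_dvd]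
      change v _ ≤ v _
      rw [← hd m₁ hm₁, hd₁, Nat.cast_one, Order.one_le_iff_ne_zero]
      intro h
      exact (hunit g).1 h hg
    obtain ⟨x, hx⟩ := h1
    obtain ⟨⟨a, s⟩, has⟩ := IsLocalization.surj Q.primeCompl x
    refine ⟨s, s.2, a, hinj ?_⟩
    rw [map_mul, map_mul, hx, ← has]
    ring
  obtain ⟨b, hb, hbQ⟩ : ∃ b ∉ Q, ∀ g ∈ Q, B.mon m₁ ∣ b * g := by
    obtain ⟨s, hs⟩ := (inferInstance : IsNoetherianRing A).noetherian Q
    have hfin : ∀ s : Finset A, (∀ g ∈ s, g ∈ Q) → ∃ b ∉ Q, ∀ g ∈ s, B.mon m₁ ∣ b * g := by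
      intro s
      induction s using Finset.cons_induction with
      | empty => exact fun _ => ⟨1, fun h => hQp.ne_top ((Ideal.eq_top_iff_one Q).2 h), by simp⟩
      | cons x s hxs ih =>
        intro h
        obtain ⟨b, hb, hbs⟩ := ih fun g hg => h g (Finset.mem_cons_of_mem hg)
        obtain ⟨b', hb', hbx⟩ := hdvd x (h x (Finset.mem_cons_self x s))
        refine ⟨b * b', fun h => (hQp.mem_or_mem h).elim hb hb', fun g hg => ?_⟩
        rcases Finset.mem_cons.1 hg with rfl | hg
        · rw [mul_assoc]
          exact hbx.mul_left _
        · rw [mul_comm b, mul_assoc]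
          exact (hbs g hg).mul_left _
    obtain ⟨b, hb, hbs⟩ := hfin s fun g hg => hs ▸ Submodule.subset_span hg
    refine ⟨b, hb, fun g hg => ?_⟩
    rw [← hs] at hg
    induction hg using Submodule.span_induction with
    | mem x hx => exact hbs x hx
    | zero => simp
    | add x y _ _ hx hy => rw [mul_add]; exact dvd_add hx hy
    | smul c x _ hx => rw [smul_eq_mul, mul_left_comm]; exact hx.mul_left c
  obtain ⟨w, hw, hwQ⟩ : ∃ w, B.coef b w ≠ 0 ∧ B.mon w ∉ Q := by
    by_contra! h
    exact hb (B.mem_of_forall_mon_mem h)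
  have hwS := B.mem_of_coef_ne_zero hw
  have hdw : d w = 0 := by
    by_contra h
    exact hwQ ((hpos w hwS).1 (Nat.pos_of_ne_zero h))
  refine ⟨w - m₁, d, ⟨hadd, fun m hm hdm => ?_⟩, hpos⟩
  obtain ⟨a, ha⟩ := hbQ _ ((hpos m hm).1 hdm)
  have h1 : B.coef a (w + m - m₁) ≠ 0 := by
    rw [← B.coef_mon_mul hm₁, ← ha, mul_comm, B.coef_mon_mul hm, add_sub_cancel_right]
    exact hw
  have h2 := B.mem_of_coef_ne_zero h1
  rw [show w + m - m₁ = m + (w - m₁) by abel] at h2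
  refine ⟨h2, ?_⟩
  have h3 := hadd _ h2 _ hm₁
  rw [show m + (w - m₁) + m₁ = m + w by abel, hadd _ hm _ hwS] at h3
  omega

/-- Let `Q` be a monomial prime ideal of height one that is stable under two nonzero homogeneous
derivations of opposite degrees `a` and `-a`. Then a Demazure root of `Q` can be moved along `a`
so that the corresponding derivation commutes with the derivation of degree `a`. -/
theorem exists_isRoot_shift_eq [CharZero K] [IsNoetherianRing A] [IsIntegrallyClosed A]
    [UniqueSums M] (Q : Ideal A) [Q.IsPrime] (hQ : Q.height = 1)
    (hmon : ∀ f ∈ Q, ∀ m, B.coef f m ≠ 0 → B.mon m ∈ Q) {D E : Derivation K A A} {a : M}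
    {c r : K} {p q : M → ℕ} (hD : B.IsHomogeneous D a c p) (hE : B.IsHomogeneous E (-a) r q)
    (hD0 : D ≠ 0) (hE0 : E ≠ 0) (hDQ : ∀ f ∈ Q, D f ∈ Q) (hEQ : ∀ f ∈ Q, E f ∈ Q) :
    ∃ e d, IsRoot B.S e d ∧ (∀ m ∈ B.S, 0 < d m ↔ B.mon m ∈ Q) ∧
      (∀ m ∈ B.S, m + a ∈ B.S → d (m + a) = d m) ∧
      ∀ m ∈ B.S, m + e ∈ B.S → p (m + e) = p m := by
  obtain ⟨e, d, h, hd⟩ := B.exists_isRoot Q hQ hmon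
  -- The face ideals of `D` and `E` are not contained in `Q`, since they are not stable.
  have hface : ∀ {D : Derivation K A A} {a : M} {c : K} {p : M → ℕ} (hD : B.IsHomogeneous D a c p),
      D ≠ 0 → (∀ f ∈ Q, D f ∈ Q) → Q ≠ B.faceIdeal hD.root ∧ (B.faceIdeal hD.root).height = 1 := by
    intro D a c p hD hD0 hDQ
    refine ⟨fun h => hD.not_stable_faceIdeal hD0 (h ▸ hDQ), ?_⟩
    rw [Ne, hD.eq_zero_iff] at hD0
    push Not at hD0
    obtain ⟨m, hm, hp⟩ := hD0
    exact B.height_faceIdeal hD.root hm (Nat.pos_of_ne_zero hp)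
  have hex : ∀ {D : Derivation K A A} {a : M} {c : K} {p : M → ℕ} (_ : B.IsHomogeneous D a c p),
      D ≠ 0 → (∀ f ∈ Q, D f ∈ Q) → ∃ m ∈ B.S, 0 < p m ∧ d m = 0 := by
    intro D a c p hD hD0 hDQ
    obtain ⟨h1, h2⟩ := hface hD hD0 hDQ
    by_contra! h3
    refine h1 (eq_of_le_of_height_eq_one hQ (Ideal.ne_bot_of_height_eq_one h2) fun f hf => ?_).symm
    refine B.mem_of_forall_mon_mem fun m hm => ?_
    have hmS := B.mem_of_coef_ne_zero hm
    refine (hd m hmS).1 (Nat.pos_of_ne_zero (h3 m hmS (Nat.pos_of_ne_zero fun h0 => hm ?_)))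
    exact (B.mem_faceIdeal hD.root).1 hf m h0
  have hda : ∀ m ∈ B.S, m + a ∈ B.S → d (m + a) = d m := by
    obtain ⟨x, hx, hpx, hdx⟩ := hex hD hD0 hDQ
    obtain ⟨y, hy, hqy, hdy⟩ := hex hE hE0 hEQ
    obtain ⟨hxa, -⟩ := hD.root.shift x hx hpx
    obtain ⟨hya, -⟩ := hE.root.shift y hy hqy
    have h1 := h.add _ hxa _ hya
    rw [show x + a + (y + -a) = x + y by abel, h.add _ hx _ hy] at h1
    intro m hm hma
    have := h.add_vec hm hx hma hxa
    omega
  have hdka : ∀ k : ℕ, ∀ m ∈ B.S, k ≤ p m → d (m + k • a) = d m := by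
    intro k
    induction k with
    | zero => simp
    | succ k ih =>
      intro m hm hk
      rw [succ_nsmul, ← add_assoc, hda _ (hD.root.add_nsmul hm (by omega)).1, ih m hm (by omega)]
      rw [add_assoc, ← succ_nsmul]
      exact (hD.root.add_nsmul hm hk).1
  obtain ⟨x, hx, hdx, hpx⟩ : ∃ x ∈ B.S, 0 < d x ∧ p x = 0 := by
    obtain ⟨h1, h2⟩ := hface hD hD0 hDQ
    by_contra! h3
    refine h1 (eq_of_le_of_height_eq_one h2 (Ideal.ne_bot_of_height_eq_one hQ) fun f hf => ?_)
    refine B.mem_of_forall_mon_mem fun m hm => ?_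
    have hmS := B.mem_of_coef_ne_zero hm
    exact (B.mon_mem_faceIdeal hD.root hmS).2 (Nat.pos_of_ne_zero
      (h3 m hmS ((hd m hmS).2 (hmon f hf m hm))))
  obtain ⟨hxe, hdxe⟩ := h.shift x hx hdx
  -- The amount `p (x + e)` by which `e` raises `p` is compensated by a multiple of `a`.
  set k := p (x + e) with hk
  have hshift : ∀ m ∈ B.S, 0 < d m → m + (e + k • a) ∈ B.S ∧ d (m + (e + k • a)) + 1 = d m ∧
      p (m + (e + k • a)) = p m := by
    intro m hm hdm
    obtain ⟨hme, hdme⟩ := h.shift m hm hdm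
    have h1 := hD.root.add_vec hm hx hme hxe
    obtain ⟨h2, h3⟩ := hD.root.add_nsmul hme (k := k) (by omega)
    have h4 := hdka k _ hme (by omega)
    rw [add_assoc] at h2 h3 h4
    exact ⟨h2, by omega, by omega⟩
  refine ⟨e + k • a, d, ⟨h.add, fun m hm hdm => ⟨(hshift m hm hdm).1, (hshift m hm hdm).2.1⟩⟩, hd,
    hda, fun m hm hme => ?_⟩
  obtain ⟨h1, -, h2⟩ := hshift x hx hdx
  have := hD.root.add_vec hm hx hme h1
  omega

end MonomialBasis

/-! ### Monomials from an open torus orbit -/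

/-- The coordinate algebra of an affine variety on which the torus `T` acts with a dense orbit has
a basis of monomials. Here the action is given by weight expansions, and the orbit map of a point
of the dense orbit embeds the algebra into the group algebra of the character group. -/
theorem exists_monomialBasis {K A M T : Type*} [Field K] [CommRing A] [IsDomain A] [Algebra K A]
    [AddCommGroup M] [Group T] {χ : M → T →* K} (hinj : Function.Injective χ)
    (hadd : ∀ m m', χ (m + m') = χ m * χ m') (τ : T →* (A ≃ₐ[K] A))
    (hreg : ∀ f, ∃ g : M →₀ A, ∀ t, τ t f = g.sum fun m a => χ m t • a) (x : A →ₐ[K] K)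
    (hx : ∀ f, (∀ t, x (τ t f) = 0) → f = 0) :
    ∃ B : MonomialBasis K A M, B.IsTorusAction χ τ := by
  have hunit : ∀ m t, χ m t ≠ 0 := fun m t => ((Group.isUnit t).map (χ m)).ne_zero
  have hχ0 : χ 0 = 1 := by
    ext t
    have h1 := DFunLike.congr_fun (hadd 0 0) t
    rw [add_zero, MonoidHom.mul_apply] at h1
    exact mul_left_cancel₀ (hunit 0 t) (by rw [← h1, MonoidHom.one_apply, mul_one])
  let F : Multiplicative M →* (T → K) :=
    { toFun := fun m t => χ m.toAdd t
      map_one' := by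
        funext t
        change χ 0 t = 1
        rw [hχ0, MonoidHom.one_apply]
      map_mul' := fun m m' => by
        funext t
        change χ (m.toAdd + m'.toAdd) t = _
        rw [hadd]
        rfl }
  let Ψ : AddMonoidAlgebra K M →ₐ[K] (T → K) := AddMonoidAlgebra.lift K (T → K) M F
  have hΨ : ∀ P, Ψ P = Finsupp.linearCombination K (fun m => ⇑(χ m)) P.coeff := fun P =>
    AddMonoidAlgebra.lift_apply F P
  have hΨ_single : ∀ m b t, Ψ (AddMonoidAlgebra.single m b) t = b * χ m t := fun m b t => by
    change AddMonoidAlgebra.lift K (T → K) M F _ t = _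
    rw [AddMonoidAlgebra.lift_single]
    rfl
  have hΨinj : Function.Injective Ψ := by
    rw [injective_iff_map_eq_zero]
    intro P hP
    rw [hΨ] at hP
    exact AddMonoidAlgebra.coeff_eq_zero.1
      (linearIndependent_iff.1 ((linearIndependent_monoidHom T K).comp χ hinj) _ hP)
  let φ : A →ₐ[K] (T → K) := AlgHom.pi fun t => x.comp (τ t : A →ₐ[K] A)
  have hφ : ∀ f t, φ f t = x (τ t f) := fun _ _ => rfl
  have hφΨ : ∀ f (g : M →₀ A), (∀ t, τ t f = g.sum fun m a => χ m t • a) →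
      Ψ (AddMonoidAlgebra.ofCoeff (g.mapRange x (map_zero x))) = φ f := by
    intro f g hg
    funext t
    rw [hΨ, hφ, hg, Finsupp.sum, map_sum, Finsupp.linearCombination_apply,
      Finsupp.sum_mapRange_index (by simp), Finsupp.sum, Finset.sum_apply]
    refine Finset.sum_congr rfl fun m _ => ?_
    rw [map_smul, Pi.smul_apply, smul_eq_mul, smul_eq_mul, mul_comm]
  have hrange : ∀ f, φ f ∈ Ψ.range := fun f => by
    obtain ⟨g, hg⟩ := hreg f
    exact ⟨_, hφΨ f g hg⟩
  let ι : A →ₐ[K] AddMonoidAlgebra K M :=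
    ((AlgEquiv.ofInjective Ψ hΨinj).symm : Ψ.range →ₐ[K] _).comp (φ.codRestrict Ψ.range hrange)
  have hι : ∀ f, Ψ (ι f) = φ f := fun f =>
    congrArg Subtype.val ((AlgEquiv.ofInjective Ψ hΨinj).apply_symm_apply ⟨φ f, hrange f⟩)
  have hιinj : Function.Injective ι := by
    rw [injective_iff_map_eq_zero]
    intro f hf
    refine hx f fun t => ?_
    rw [← hφ, ← hι, hf, map_zero, Pi.zero_apply]
  -- The components of `f` in a weight expansion are weight vectors.
  have hweight : ∀ f (g : M →₀ A), (∀ t, τ t f = g.sum fun m a => χ m t • a) →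
      ∀ m s, τ s (g m) = χ m s • g m := by
    intro f g hg m s
    by_cases hm : m ∈ g.support
    swap
    · rw [Finsupp.notMem_support_iff.1 hm, map_zero, smul_zero]
    let ψ : M → T →* A := fun m => ((algebraMap K A) : K →* A).comp (χ m)
    have hψ : Function.Injective ψ := by
      intro m m' h
      apply hinj
      ext t
      exact FaithfulSMul.algebraMap_injective K A (DFunLike.congr_fun h t)
    have hli := (linearIndependent_monoidHom T A).comp ψ hψ
    have h0 : ∑ m ∈ g.support, (τ s (g m) - χ m s • g m) • (fun t => ψ m t) = 0 := by
      funext t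
      have h1 : ∑ m ∈ g.support, χ m t • τ s (g m) =
          ∑ m ∈ g.support, χ m t • χ m s • g m := by
        have h2 : τ s (τ t f) = τ (s * t) f := by rw [map_mul, AlgEquiv.mul_apply]
        rw [hg, hg, Finsupp.sum, Finsupp.sum, map_sum] at h2
        simpa only [map_smul, map_mul, mul_smul, smul_comm (χ _ s)] using h2
      rw [Finset.sum_apply, Pi.zero_apply, ← sub_eq_zero.2 h1, ← Finset.sum_sub_distrib]
      refine Finset.sum_congr rfl fun m _ => ?_
      rw [Pi.smul_apply, smul_eq_mul, ← smul_sub, mul_comm]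
      exact (Algebra.smul_def _ _).symm
    exact sub_eq_zero.1 (linearIndependent_iff'.1 hli _ _ h0 m hm)
  have hsingle : ∀ (m : M) (h : A), (∀ s, τ s h = χ m s • h) →
      ι h = AddMonoidAlgebra.single m (x h) := by
    intro m h hh
    apply hΨinj
    funext t
    rw [hι, hφ, hh, map_smul, hΨ_single, smul_eq_mul, mul_comm]
  have hmem : ∀ f m, (ι f).coeff m ≠ 0 → ∃ h, ι h = AddMonoidAlgebra.single m 1 := by
    intro f m hm
    obtain ⟨g, hg⟩ := hreg f
    have h1 : ι f = AddMonoidAlgebra.ofCoeff (g.mapRange x (map_zero x)) :=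
      hΨinj ((hι f).trans (hφΨ f g hg).symm)
    rw [h1, AddMonoidAlgebra.coeff_ofCoeff, Finsupp.mapRange_apply] at hm
    refine ⟨(x (g m))⁻¹ • g m, ?_⟩
    rw [map_smul, hsingle m _ (hweight f g hg m), AddMonoidAlgebra.smul_single, smul_eq_mul,
      inv_mul_cancel₀ hm]
  classical
  let mon : M → A := fun m => if h : ∃ h, ι h = AddMonoidAlgebra.single m 1 then h.choose else 0
  have hmon : ∀ m, (∃ h, ι h = AddMonoidAlgebra.single m 1) →
      ι (mon m) = AddMonoidAlgebra.single m 1 := by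
    intro m h
    simp only [mon, dif_pos h]
    exact h.choose_spec
  let S : AddSubmonoid M :=
    { carrier := {m | ∃ h, ι h = AddMonoidAlgebra.single m 1}
      zero_mem' := ⟨1, by rw [map_one, AddMonoidAlgebra.one_def]⟩
      add_mem' := fun {m m'} ⟨h, hh⟩ ⟨h', hh'⟩ =>
        ⟨h * h', by rw [map_mul, hh, hh', AddMonoidAlgebra.single_mul_single, mul_one]⟩ }
  have hS : ∀ m ∈ S, ι (mon m) = AddMonoidAlgebra.single m 1 := fun m hm => hmon m hm
  let B : MonomialBasis K A M :=
    { S := S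
      mon := mon
      coef := (AddMonoidAlgebra.coeffLinearEquiv K).toLinearMap ∘ₗ ι.toLinearMap
      mon_zero := hιinj (by rw [hS 0 S.zero_mem, map_one, AddMonoidAlgebra.one_def])
      mon_add := fun {m m'} hm hm' => hιinj (by
        rw [hS _ (S.add_mem hm hm'), map_mul, hS m hm, hS m' hm',
          AddMonoidAlgebra.single_mul_single, mul_one])
      coef_mon := fun {m} hm => by
        change (ι (mon m)).coeff = _
        rw [hS m hm, AddMonoidAlgebra.coeff_single]
      mem_of_coef_ne_zero := fun {f m} h => hmem f m h
      coef_injective := (AddMonoidAlgebra.coeffLinearEquiv K).injective.comp hιinj }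
  refine ⟨B, hinj, hadd, fun t m hm => hιinj (hΨinj ?_)⟩
  funext s
  have h1 : ∀ s, x (τ s (mon m)) = χ m s := fun s => by
    rw [← hφ, ← hι, hS m hm, hΨ_single, one_mul]
  rw [hι, hι, map_smul, Pi.smul_apply, hφ, hφ]
  change x (τ s (τ t (mon m))) = χ m t • x (τ s (mon m))
  rw [← AlgEquiv.mul_apply, ← map_mul, h1, h1, map_mul, smul_eq_mul, mul_comm]

/-! ### The torus and the root subgroups of `SL₂ × T'` -/

section Subgroups

variable (K : Type*) [Field K] (n : ℕ)

section Matrices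

variable {K}

/-- The diagonal matrix with entries `a` and `a⁻¹`. -/
def diagSL (a : Kˣ) : SL(2, K) := ⟨!![(a : K), 0; 0, (a : K)⁻¹], by simp [Matrix.det_fin_two_of]⟩

/-- The upper unitriangular matrix with entry `s`. -/
def upSL (s : K) : SL(2, K) := ⟨!![1, s; 0, 1], by simp [Matrix.det_fin_two_of]⟩

/-- The lower unitriangular matrix with entry `s`. -/
def lowSL (s : K) : SL(2, K) := ⟨!![1, 0; s, 1], by simp [Matrix.det_fin_two_of]⟩

variable (K) in
/-- A representative of the nontrivial element of the Weyl group of `SL₂`. -/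
def weylSL : SL(2, K) := ⟨!![0, 1; -1, 0], by simp [Matrix.det_fin_two_of]⟩

@[simp]
theorem coe_diagSL (a : Kˣ) :
    (diagSL a : Matrix (Fin 2) (Fin 2) K) = !![(a : K), 0; 0, (a : K)⁻¹] := rfl

@[simp]
theorem coe_upSL (s : K) : (upSL s : Matrix (Fin 2) (Fin 2) K) = !![1, s; 0, 1] := rfl

@[simp]
theorem coe_lowSL (s : K) : (lowSL s : Matrix (Fin 2) (Fin 2) K) = !![1, 0; s, 1] := rfl

@[simp]
theorem coe_weylSL : (weylSL K : Matrix (Fin 2) (Fin 2) K) = !![0, 1; -1, 0] := rfl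

end Matrices

/-- The diagonal torus as a homomorphism. -/
def diagHom : Kˣ × (Fin n → Kˣ) →* G K n where
  toFun t := (diagSL t.1, t.2)
  map_one' := by
    refine Prod.ext (Subtype.ext ?_) rfl
    ext i j
    fin_cases i <;> fin_cases j <;> simp
  map_mul' s t := by
    refine Prod.ext (Subtype.ext ?_) rfl
    ext i j
    fin_cases i <;> fin_cases j <;> simp [mul_comm]

/-- The upper unitriangular matrices as an additive one-parameter group. -/
def upHom : Multiplicative K →* G K n where
  toFun s := (upSL s.toAdd, 1)
  map_one' := by
    refine Prod.ext (Subtype.ext ?_) rfl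
    ext i j
    fin_cases i <;> fin_cases j <;> simp
  map_mul' s t := by
    refine Prod.ext (Subtype.ext ?_) (mul_one _).symm
    ext i j
    fin_cases i <;> fin_cases j <;> simp [add_comm]

/-- The lower unitriangular matrices as an additive one-parameter group. -/
def lowHom : Multiplicative K →* G K n where
  toFun s := (lowSL s.toAdd, 1)
  map_one' := by
    refine Prod.ext (Subtype.ext ?_) rfl
    ext i j
    fin_cases i <;> fin_cases j <;> simp
  map_mul' s t := by
    refine Prod.ext (Subtype.ext ?_) (mul_one _).symm
    ext i j
    fin_cases i <;> fin_cases j <;> simp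

/-- A representative in `G` of the nontrivial element of the Weyl group. -/
def weyl : G K n := (weylSL K, 1)

variable {K n}

theorem G.ext {g h : G K n} (h00 : g.1 0 0 = h.1 0 0) (h01 : g.1 0 1 = h.1 0 1)
    (h10 : g.1 1 0 = h.1 1 0) (h11 : g.1 1 1 = h.1 1 1) (h2 : g.2 = h.2) : g = h := by
  refine Prod.ext (Subtype.ext ?_) h2
  ext i j
  fin_cases i <;> fin_cases j <;> assumption

theorem G.det_eq (g : G K n) : g.1 0 0 * g.1 1 1 - g.1 0 1 * g.1 1 0 = 1 := by
  rw [← Matrix.det_fin_two]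
  exact g.1.2

theorem mem_stdBorel {g : G K n} : g ∈ stdBorel K n ↔ g.1 1 0 = 0 := Iff.rfl

theorem mem_stdTorus {g : G K n} : g ∈ stdTorus K n ↔ g.1 1 0 = 0 ∧ g.1 0 1 = 0 := Iff.rfl

theorem mem_stdUnipotent {g : G K n} :
    g ∈ stdUnipotent K n ↔ g.1 1 0 = 0 ∧ g.1 0 0 = 1 ∧ g.1 1 1 = 1 ∧ g.2 = 1 := Iff.rfl

theorem exists_eq_diagHom_mul_upHom {g : G K n} (hg : g ∈ stdBorel K n) :
    ∃ t s, g = diagHom K n t * upHom K n s := by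
  have hdet := G.det_eq g
  rw [mem_stdBorel.1 hg, mul_zero, sub_zero] at hdet
  let a : Kˣ := ⟨g.1 0 0, g.1 1 1, hdet, by rw [mul_comm, hdet]⟩
  have ha : (g.1 0 0)⁻¹ = g.1 1 1 := inv_eq_of_mul_eq_one_right hdet
  refine ⟨(a, g.2), Multiplicative.ofAdd (g.1 0 1 * g.1 1 1), G.ext ?_ ?_ ?_ ?_ ?_⟩
  · simp [diagHom, upHom, Matrix.mul_apply, Fin.sum_univ_two, a]
  · simp [diagHom, upHom, Matrix.mul_apply, Fin.sum_univ_two, a]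
    linear_combination -(g.1 0 1) * hdet
  · simp [diagHom, upHom, Matrix.mul_apply, Fin.sum_univ_two, mem_stdBorel.1 hg]
  · simp [diagHom, upHom, Matrix.mul_apply, Fin.sum_univ_two, a, ha]
  · simp [diagHom, upHom]

theorem diagHom_mem_stdBorel (t : Kˣ × (Fin n → Kˣ)) : diagHom K n t ∈ stdBorel K n := by
  simp [mem_stdBorel, diagHom]

theorem upHom_mem_stdBorel (s : Multiplicative K) : upHom K n s ∈ stdBorel K n := by
  simp [mem_stdBorel, upHom]

theorem stdTorus_eq_range : stdTorus K n = (diagHom K n).range := by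
  ext g
  constructor
  · intro hg
    obtain ⟨h1, h2⟩ := mem_stdTorus.1 hg
    have hdet := G.det_eq g
    rw [h1, mul_zero, sub_zero] at hdet
    refine ⟨(⟨g.1 0 0, g.1 1 1, hdet, by rw [mul_comm, hdet]⟩, g.2), G.ext ?_ ?_ ?_ ?_ ?_⟩ <;>
      simp [diagHom, h1, h2, inv_eq_of_mul_eq_one_right hdet]
  · rintro ⟨t, rfl⟩
    simp [mem_stdTorus, diagHom]

theorem stdUnipotent_eq_range : stdUnipotent K n = (upHom K n).range := by
  ext g
  constructor
  · intro hg
    obtain ⟨h1, h2, h3, h4⟩ := mem_stdUnipotent.1 hg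
    refine ⟨Multiplicative.ofAdd (g.1 0 1), G.ext ?_ ?_ ?_ ?_ ?_⟩ <;> simp [upHom, h1, h2, h3, h4]
  · rintro ⟨t, rfl⟩
    simp [mem_stdUnipotent, upHom]

/-- The group `G` is generated by the diagonal torus and the two root subgroups. -/
theorem G.induction {p : G K n → Prop} (g : G K n) (diag : ∀ t, p (diagHom K n t))
    (up : ∀ s, p (upHom K n s)) (low : ∀ s, p (lowHom K n s))
    (mul : ∀ g h, p g → p h → p (g * h)) : p g := by
  have hborel : ∀ g ∈ stdBorel K n, p g := by
    intro g hg
    obtain ⟨t, s, rfl⟩ := exists_eq_diagHom_mul_upHom hg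
    exact mul _ _ (diag t) (up s)
  -- A matrix with nonzero lower left entry becomes upper triangular after row and column moves.
  have hne : ∀ g : G K n, g.1 1 1 ≠ 0 → p g := by
    intro g hg
    have h : g = (g * lowHom K n (Multiplicative.ofAdd (-(g.1 1 0 / g.1 1 1)))) *
        lowHom K n (Multiplicative.ofAdd (g.1 1 0 / g.1 1 1)) := by
      rw [mul_assoc, ← map_mul, ← ofAdd_add, neg_add_cancel, ofAdd_zero, map_one, mul_one]
    rw [h]
    refine mul _ _ (hborel _ ?_) (low _)
    rw [mem_stdBorel]
    simp [lowHom, Matrix.mul_apply, Fin.sum_univ_two]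
    field_simp
    ring
  by_cases hg : g.1 1 1 = 0
  · have hdet := G.det_eq g
    have h10 : g.1 1 0 ≠ 0 := by
      intro h
      rw [hg, h] at hdet
      simp at hdet
    have h : g = (g * upHom K n (Multiplicative.ofAdd 1)) *
        upHom K n (Multiplicative.ofAdd (-1)) := by
      rw [mul_assoc, ← map_mul, ← ofAdd_add, add_neg_cancel, ofAdd_zero, map_one, mul_one]
    rw [h]
    refine mul _ _ (hne _ ?_) (up _)
    simpa [upHom, Matrix.mul_apply, Fin.sum_univ_two, hg] using h10
  · exact hne g hg

theorem diagHom_mul_upHom (t : Kˣ × (Fin n → Kˣ)) (s : K) :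
    diagHom K n t * upHom K n (Multiplicative.ofAdd s) =
      upHom K n (Multiplicative.ofAdd ((t.1 : K) ^ 2 * s)) * diagHom K n t := by
  refine G.ext ?_ ?_ ?_ ?_ ?_ <;>
    simp [diagHom, upHom, Matrix.mul_apply, Fin.sum_univ_two]
  field_simp

theorem diagHom_mul_lowHom (t : Kˣ × (Fin n → Kˣ)) (s : K) :
    diagHom K n t * lowHom K n (Multiplicative.ofAdd s) =
      lowHom K n (Multiplicative.ofAdd (((t.1 : K) ^ 2)⁻¹ * s)) * diagHom K n t := by
  refine G.ext ?_ ?_ ?_ ?_ ?_ <;>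
    simp [diagHom, lowHom, Matrix.mul_apply, Fin.sum_univ_two]
  field_simp

theorem weyl_mul_upHom (s : K) :
    weyl K n * upHom K n (Multiplicative.ofAdd s) =
      lowHom K n (Multiplicative.ofAdd (-s)) * weyl K n := by
  refine G.ext ?_ ?_ ?_ ?_ ?_ <;>
    simp [weyl, upHom, lowHom, Matrix.mul_apply, Fin.sum_univ_two]

/-- The restriction of a regular function to a one-parameter subgroup with polynomial matrix
entries is a polynomial. -/
theorem exists_polynomial_of_regular {w : K → G K n}
    (hw : ∀ i j, ∃ P : Polynomial K, ∀ s, (w s).1 i j = P.eval s) (hw2 : ∀ s, (w s).2 = 1)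
    {c : G K n → K} (hc : c ∈ regularFunctions K n) :
    ∃ P : Polynomial K, ∀ s, c (w s) = P.eval s := by
  induction hc using Algebra.adjoin_induction with
  | mem c hc =>
    rcases hc with (⟨i, j, rfl⟩ | ⟨i, rfl⟩) | ⟨i, rfl⟩
    · exact hw i j
    · exact ⟨1, fun s => by simp [hw2]⟩
    · exact ⟨1, fun s => by simp [hw2]⟩
  | algebraMap r => exact ⟨Polynomial.C r, fun s => by simp⟩
  | add c c' _ _ h h' =>
    obtain ⟨P, hP⟩ := h
    obtain ⟨P', hP'⟩ := h'
    exact ⟨P + P', fun s => by rw [Pi.add_apply, hP, hP', Polynomial.eval_add]⟩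
  | mul c c' _ _ h h' =>
    obtain ⟨P, hP⟩ := h
    obtain ⟨P', hP'⟩ := h'
    exact ⟨P * P', fun s => by rw [Pi.mul_apply, hP, hP', Polynomial.eval_mul]⟩

theorem exists_polynomial_upHom {c : G K n → K} (hc : c ∈ regularFunctions K n) :
    ∃ P : Polynomial K, ∀ s, c (upHom K n (Multiplicative.ofAdd s)) = P.eval s := by
  refine exists_polynomial_of_regular (w := fun s => upHom K n (Multiplicative.ofAdd s))
    (fun i j => ?_) (fun s => rfl) hc
  refine ⟨(!![1, Polynomial.X; 0, 1] : Matrix (Fin 2) (Fin 2) (Polynomial K)) i j, fun s => ?_⟩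
  fin_cases i <;> fin_cases j <;> simp [upHom]

theorem exists_polynomial_lowHom {c : G K n → K} (hc : c ∈ regularFunctions K n) :
    ∃ P : Polynomial K, ∀ s, c (lowHom K n (Multiplicative.ofAdd s)) = P.eval s := by
  refine exists_polynomial_of_regular (w := fun s => lowHom K n (Multiplicative.ofAdd s))
    (fun i j => ?_) (fun s => rfl) hc
  refine ⟨(!![1, 0; Polynomial.X, 1] : Matrix (Fin 2) (Fin 2) (Polynomial K)) i j, fun s => ?_⟩
  fin_cases i <;> fin_cases j <;> simp [lowHom]

/-! ### Characters of the torus -/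

variable (K) in
/-- The character `(a, t) ↦ a ^ m₀ * ∏ tᵢ ^ mᵢ` of the diagonal torus. -/
def torusChar (m : ℤ × (Fin n → ℤ)) : Kˣ × (Fin n → Kˣ) →* K where
  toFun t := ((t.1 ^ m.1 * ∏ i, t.2 i ^ m.2 i : Kˣ) : K)
  map_one' := by simp
  map_mul' s t := by
    rw [← Units.val_mul]
    congr 1
    simp only [Prod.fst_mul, Prod.snd_mul, Pi.mul_apply, mul_zpow, Finset.prod_mul_distrib]
    exact mul_mul_mul_comm _ _ _ _

theorem torusChar_apply (m : ℤ × (Fin n → ℤ)) (t : Kˣ × (Fin n → Kˣ)) :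
    torusChar K m t = ((t.1 ^ m.1 * ∏ i, t.2 i ^ m.2 i : Kˣ) : K) := rfl

theorem torusChar_add (m m' : ℤ × (Fin n → ℤ)) :
    torusChar K (m + m') = torusChar K m * torusChar K m' := by
  ext t
  rw [MonoidHom.mul_apply, torusChar_apply, torusChar_apply, torusChar_apply, ← Units.val_mul]
  congr 1
  simp only [Prod.fst_add, Prod.snd_add, Pi.add_apply, zpow_add, Finset.prod_mul_distrib]
  exact mul_mul_mul_comm _ _ _ _

theorem torusChar_injective [CharZero K] :
    Function.Injective (torusChar K : ℤ × (Fin n → ℤ) → Kˣ × (Fin n → Kˣ) →* K) := by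
  have htwo : Function.Injective fun k : ℤ => (Units.mk0 (2 : K) two_ne_zero) ^ k := by
    intro k l h
    have h1 := congrArg Units.val h
    simp only [Units.val_zpow_eq_zpow_val, Units.val_mk0] at h1
    have h2 : (2 : ℚ) ^ k = (2 : ℚ) ^ l := by
      apply Rat.cast_injective (α := K)
      push_cast
      exact h1
    exact zpow_right_injective₀ two_pos (by norm_num) h2
  intro m m' h
  have h' : ∀ t : Kˣ × (Fin n → Kˣ),
      t.1 ^ m.1 * ∏ i, t.2 i ^ m.2 i = t.1 ^ m'.1 * ∏ i, t.2 i ^ m'.2 i := fun t =>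
    Units.ext (DFunLike.congr_fun h t)
  refine Prod.ext (htwo ?_) (funext fun i => htwo ?_)
  · simpa using h' (Units.mk0 2 two_ne_zero, 1)
  · have h1 := h' (1, Pi.mulSingle i (Units.mk0 2 two_ne_zero))
    simp only [one_zpow, one_mul] at h1
    rwa [Finset.prod_eq_single i (fun j _ hj => by rw [Pi.mulSingle_eq_of_ne hj, one_zpow])
      (by simp), Finset.prod_eq_single i (fun j _ hj => by rw [Pi.mulSingle_eq_of_ne hj, one_zpow])
      (by simp), Pi.mulSingle_eq_same] at h1

/-- The restriction of a regular function to the torus is a combination of characters. -/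
theorem exists_characters_of_regular {c : G K n → K} (hc : c ∈ regularFunctions K n) :
    ∃ P : (ℤ × (Fin n → ℤ)) →₀ K, ∀ t,
      c (diagHom K n t) = P.sum fun m b => torusChar K m t * b := by
  have hsingle : ∀ (m : ℤ × (Fin n → ℤ)) (b : K) (t : Kˣ × (Fin n → Kˣ)),
      ((Finsupp.single m b).sum fun m b => torusChar K m t * b) = torusChar K m t * b :=
    fun m b t => Finsupp.sum_single_index (mul_zero _)
  induction hc using Algebra.adjoin_induction with
  | mem c hc =>
    rcases hc with (⟨i, j, rfl⟩ | ⟨i, rfl⟩) | ⟨i, rfl⟩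
    · fin_cases i <;> fin_cases j
      · refine ⟨Finsupp.single (1, 0) 1, fun t => ?_⟩
        rw [hsingle]
        simp [torusChar_apply, diagHom]
      · exact ⟨0, fun t => by simp [diagHom]⟩
      · exact ⟨0, fun t => by simp [diagHom]⟩
      · refine ⟨Finsupp.single (-1, 0) 1, fun t => ?_⟩
        rw [hsingle]
        simp [torusChar_apply, diagHom]
    · refine ⟨Finsupp.single (0, Pi.single i 1) 1, fun t => ?_⟩
      rw [hsingle, torusChar_apply, Finset.prod_eq_single i
        (fun j _ hj => by simp [Pi.single_eq_of_ne hj]) (by simp)]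
      simp [diagHom]
    · refine ⟨Finsupp.single (0, Pi.single i (-1)) 1, fun t => ?_⟩
      rw [hsingle, torusChar_apply, Finset.prod_eq_single i
        (fun j _ hj => by simp [Pi.single_eq_of_ne hj]) (by simp)]
      simp [diagHom]
  | algebraMap r =>
    refine ⟨Finsupp.single 0 r, fun t => ?_⟩
    rw [hsingle]
    simp [torusChar_apply]
  | add c c' _ _ h h' =>
    obtain ⟨P, hP⟩ := h
    obtain ⟨P', hP'⟩ := h'
    refine ⟨P + P', fun t => ?_⟩
    rw [Pi.add_apply, hP, hP', Finsupp.sum_add_index' (by simp) (by simp [mul_add])]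
  | mul c c' _ _ h h' =>
    obtain ⟨P, hP⟩ := h
    obtain ⟨P', hP'⟩ := h'
    refine ⟨P.sum fun m b => P'.sum fun m' b' => Finsupp.single (m + m') (b * b'), fun t => ?_⟩
    rw [Pi.mul_apply, hP, hP', Finsupp.sum_sum_index (by simp) (by simp [mul_add]),
      Finsupp.sum_mul]
    refine Finsupp.sum_congr fun m _ => ?_
    rw [Finsupp.sum_sum_index (by simp) (by simp [mul_add]), Finsupp.mul_sum]
    refine Finsupp.sum_congr fun m' _ => ?_
    rw [hsingle, torusChar_add, MonoidHom.mul_apply]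
    ring

end Subgroups

/-! ### Toric coordinates for an action of `SL₂ × T'` -/

section Construction

variable {K A : Type*} [Field K] [CommRing A] [Algebra K A] {n : ℕ}
  {θ : G K n →* (A ≃ₐ[K] A)}

theorem IsRegularAction.comp_conj {ρ : G K n →* (A ≃ₐ[K] A)} (hρ : IsRegularAction ρ) (γ : G K n) :
    IsRegularAction (ρ.comp (MulAut.conj γ).toMonoidHom) := by
  intro f
  obtain ⟨m, c, a, hc, h⟩ := hρ (ρ γ⁻¹ f)
  refine ⟨m, c, fun i => ρ γ (a i), hc, fun g => ?_⟩
  change ρ (γ * g * γ⁻¹) f = _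
  rw [map_mul, map_mul, AlgEquiv.mul_apply, AlgEquiv.mul_apply, h, map_sum]
  simp only [map_smul]

theorem IsRegularAction.exists_weights (hθ : IsRegularAction θ) (f : A) :
    ∃ g : (ℤ × (Fin n → ℤ)) →₀ A, ∀ t,
      (θ.comp (diagHom K n)) t f = g.sum fun m a => torusChar K m t • a := by
  obtain ⟨k, c, a, hc, h⟩ := hθ f
  choose P hP using fun i => exists_characters_of_regular (hc i)
  have hsum : ∀ s : Finset (Fin k), ∃ g : (ℤ × (Fin n → ℤ)) →₀ A, ∀ t,
      ∑ i ∈ s, c i (diagHom K n t) • a i = g.sum fun m a => torusChar K m t • a := by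
    intro s
    induction s using Finset.cons_induction with
    | empty => exact ⟨0, fun t => by simp⟩
    | cons i s hi ih =>
      obtain ⟨g, hg⟩ := ih
      refine ⟨(P i).mapRange (fun b => b • a i) (zero_smul _ _) + g, fun t => ?_⟩
      rw [Finset.sum_cons, hg, Finsupp.sum_add_index' (by simp) (by simp),
        Finsupp.sum_mapRange_index (by simp), hP]
      simp only [Finsupp.sum, Finset.sum_smul, mul_smul]
  obtain ⟨g, hg⟩ := hsum Finset.univ
  exact ⟨g, fun t => (h _).trans (hg t)⟩

theorem IsRegularAction.exists_polynomial (hθ : IsRegularAction θ) {w : Multiplicative K →* G K n}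
    (hw : ∀ c ∈ regularFunctions K n, ∃ P : Polynomial K, ∀ s,
      c (w (Multiplicative.ofAdd s)) = P.eval s) (f : A) :
    ∃ p : Polynomial A, ∀ s : K,
      (θ.comp w) (Multiplicative.ofAdd s) f = p.eval (algebraMap K A s) := by
  obtain ⟨k, c, a, hc, h⟩ := hθ f
  choose P hP using fun i => hw _ (hc i)
  refine ⟨∑ i, Polynomial.C (a i) * (P i).map (algebraMap K A), fun s => ?_⟩
  rw [MonoidHom.comp_apply, h, Polynomial.eval_finsetSum]
  refine Finset.sum_congr rfl fun i _ => ?_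
  rw [Polynomial.eval_mul, Polynomial.eval_C, Polynomial.eval_map, Polynomial.eval₂_at_apply, hP,
    Algebra.smul_def, mul_comm]

theorem HasOpenOrbit.exists_dense [IsAlgClosed K] [IsDomain A] [Algebra.FiniteType K A]
    {ρ : G K n →* (A ≃ₐ[K] A)} {γ : G K n} (h : HasOpenOrbit ρ (torus γ)) :
    ∃ x : A →ₐ[K] K, ∀ f,
      (∀ t, x (((ρ.comp (MulAut.conj γ).toMonoidHom).comp (diagHom K n)) t f) = 0) → f = 0 := by
  obtain ⟨x, hx⟩ := h
  refine ⟨x.eval, fun f hf => ?_⟩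
  obtain ⟨g, hg, hgW⟩ := exists_basic_subset hx ⟨x, 1, one_mem _, one_smul _ x⟩
  refine (mul_eq_zero.1 (eq_zero_of_forall_eval_eq_zero (K := K) (f := f * g)
    fun y => ?_)).resolve_right hg
  rw [map_mul, mul_eq_zero, or_iff_not_imp_right]
  intro hy
  obtain ⟨_, ⟨_, ⟨s, hs, rfl⟩, rfl⟩, rfl⟩ := hgW y hy
  rw [SetLike.mem_coe, stdTorus_eq_range] at hs
  obtain ⟨t, rfl⟩ := hs
  have h1 := hf t⁻¹
  rw [map_inv] at h1
  exact h1

end Construction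

/-- Coordinates on a toric variety with an action `θ` of `SL₂ × T'`: a basis of monomials for the
torus, and the generators of the two root subgroups of `SL₂`, which are homogeneous derivations of
opposite degrees. -/
structure Frame {K A : Type*} [Field K] [CommRing A] [Algebra K A] {n : ℕ}
    (θ : G K n →* (A ≃ₐ[K] A)) where
  /-- The monomials. -/
  B : MonomialBasis K A (ℤ × (Fin n → ℤ))
  torus : B.IsTorusAction (torusChar K) (θ.comp (diagHom K n))
  /-- The generator of the upper root subgroup. -/
  up : Derivation K A A
  /-- The generator of the lower root subgroup. -/
  low : Derivation K A A
  flow_up : IsFlow (θ.comp (upHom K n)) up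
  flow_low : IsFlow (θ.comp (lowHom K n)) low
  /-- The scalar factor of `up`. -/
  cUp : K
  /-- The valuation of `up`. -/
  dUp : ℤ × (Fin n → ℤ) → ℕ
  hom_up : B.IsHomogeneous up (2, 0) cUp dUp
  /-- The scalar factor of `low`. -/
  cLow : K
  /-- The valuation of `low`. -/
  dLow : ℤ × (Fin n → ℤ) → ℕ
  hom_low : B.IsHomogeneous low (-(2, 0)) cLow dLow
  up_eq_zero_iff : up = 0 ↔ low = 0

section FrameExistence

variable {K A : Type*} [Field K] [CharZero K] [CommRing A] [IsDomain A] [Algebra K A] {n : ℕ}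
  {θ : G K n →* (A ≃ₐ[K] A)}

theorem exists_frame (hθ : IsRegularAction θ) (x : A →ₐ[K] K)
    (hx : ∀ f, (∀ t, x ((θ.comp (diagHom K n)) t f) = 0) → f = 0) : Nonempty (Frame θ) := by
  obtain ⟨B, hB⟩ := exists_monomialBasis torusChar_injective torusChar_add
    (θ.comp (diagHom K n)) hθ.exists_weights x hx
  obtain ⟨E, hE⟩ := exists_isFlow (hθ.exists_polynomial fun c hc => exists_polynomial_upHom hc)
  obtain ⟨F, hF⟩ := exists_isFlow (hθ.exists_polynomial fun c hc => exists_polynomial_lowHom hc)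
  have hEt : ∀ t f, (θ.comp (diagHom K n)) t (E f) =
      torusChar K (2, 0) t • E ((θ.comp (diagHom K n)) t f) := by
    intro t f
    refine (hE.conj_derivation hE _ ((t.1 : K) ^ 2) (fun f => ?_) f).trans ?_
    · simp only [MonoidHom.comp_apply]
      rw [← AlgEquiv.mul_apply, ← map_mul, diagHom_mul_upHom, mul_one, map_mul,
        AlgEquiv.mul_apply]
    · congr 1
      simp [torusChar_apply]
  have hFt : ∀ t f, (θ.comp (diagHom K n)) t (F f) =
      torusChar K (-(2, 0)) t • F ((θ.comp (diagHom K n)) t f) := by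
    intro t f
    refine (hF.conj_derivation hF _ (((t.1 : K) ^ 2)⁻¹) (fun f => ?_) f).trans ?_
    · simp only [MonoidHom.comp_apply]
      rw [← AlgEquiv.mul_apply, ← map_mul, diagHom_mul_lowHom, mul_one, map_mul,
        AlgEquiv.mul_apply]
    · congr 1
      simp [torusChar_apply]
  obtain ⟨c, d, hd⟩ := hB.exists_isHomogeneous hE.exists_iterate_eq_zero hEt
  obtain ⟨c', d', hd'⟩ := hB.exists_isHomogeneous hF.exists_iterate_eq_zero hFt
  refine ⟨⟨B, hB, E, F, hE, hF, c, d, hd, c', d', hd', ?_⟩⟩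
  -- The two root subgroups are conjugate under the Weyl group.
  have hw : ∀ s, θ (upHom K n (Multiplicative.ofAdd s)) =
      (θ (weyl K n))⁻¹ * θ (lowHom K n (Multiplicative.ofAdd (-s))) * θ (weyl K n) := by
    intro s
    rw [mul_assoc, ← map_mul, ← weyl_mul_upHom, map_mul, inv_mul_cancel_left]
  rw [← hE.eq_one_iff, ← hF.eq_one_iff]
  constructor
  · intro h
    refine MonoidHom.ext fun s => ?_
    have h1 := hw (-s.toAdd)
    have h2 : θ (upHom K n (Multiplicative.ofAdd (-s.toAdd))) = 1 := DFunLike.congr_fun h _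
    rw [h2, neg_neg, eq_comm, mul_eq_one_iff_eq_inv, mul_eq_left] at h1
    exact h1
  · intro h
    refine MonoidHom.ext fun s => ?_
    have h1 := hw s.toAdd
    have h2 : θ (lowHom K n (Multiplicative.ofAdd (-s.toAdd))) = 1 := DFunLike.congr_fun h _
    rw [h2, mul_one, inv_mul_cancel] at h1
    exact h1

end FrameExistence

/-! ### Root subgroups in toric coordinates -/

namespace Frame

section Generators

variable {K A : Type*} [Field K] [CharZero K] [CommRing A] [Algebra K A] {n : ℕ}
  {θ : G K n →* (A ≃ₐ[K] A)} {F : Frame θ} {σ : Multiplicative K →* (A ≃ₐ[K] A)}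
  {D : Derivation K A A} {e : ℤ × (Fin n → ℤ)} {c : K} {d : ℤ × (Fin n → ℤ) → ℕ}

/-- The additive group action `σ` is generated by a nonzero homogeneous derivation `D` commuting
with the root subgroup of the Borel subgroup. The image of `σ` is then normalized by the Borel
subgroup, and every `𝔾ₐ`-subgroup normalized by it arises in this way. -/
structure IsGenerator (F : Frame θ) (σ : Multiplicative K →* (A ≃ₐ[K] A)) (D : Derivation K A A)
    (e : ℤ × (Fin n → ℤ)) (c : K) (d : ℤ × (Fin n → ℤ) → ℕ) : Prop where
  flow : IsFlow σ D
  ne_zero : D ≠ 0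
  hom : F.B.IsHomogeneous D e c d
  commute : ∀ f, D (F.up f) = F.up (D f)

theorem IsGenerator.exists_pos (h : F.IsGenerator σ D e c d) : ∃ m ∈ F.B.S, 0 < d m := by
  have h0 := h.ne_zero
  rw [Ne, h.hom.eq_zero_iff] at h0
  push Not at h0
  obtain ⟨m, hm, hd⟩ := h0
  exact ⟨m, hm, Nat.pos_of_ne_zero hd⟩

/-- A derivation not vanishing on the invariants of the unipotent radical is nonzero on an
invariant monomial. -/
theorem IsGenerator.exists_of_horizontal (h : F.IsGenerator σ D e c d)
    (hh : ¬ ∀ f, F.up f = 0 → D f = 0) : ∃ m ∈ F.B.S, F.dUp m = 0 ∧ 0 < d m := by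
  by_contra! h1
  exact hh fun f hf => h.hom.apply_eq_zero fun m hm => Nat.le_zero.1
    (h1 m (F.B.mem_of_coef_ne_zero hm) (F.hom_up.eq_zero_of_apply_eq_zero hf hm))

/-- A prime ideal is stable under `SL₂ × T'` if and only if it is stable under the diagonal torus
and the generators of the two root subgroups. -/
theorem stable_iff (F : Frame θ) (Q : Ideal A) [Q.IsPrime] :
    (∀ g, ∀ f ∈ Q, θ g f ∈ Q) ↔ (∀ t, ∀ f ∈ Q, θ.comp (diagHom K n) t f ∈ Q) ∧
      (∀ f ∈ Q, F.up f ∈ Q) ∧ ∀ f ∈ Q, F.low f ∈ Q := by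
  rw [← F.flow_up.stable_iff, ← F.flow_low.stable_iff]
  refine ⟨fun h => ⟨fun t => h _, fun s => h _, fun s => h _⟩, fun ⟨ht, hu, hl⟩ g => ?_⟩
  induction g using G.induction with
  | diag t => exact ht t
  | up s => exact hu s
  | low s => exact hl s
  | mul g h hg hh =>
    intro f hf
    rw [map_mul]
    exact hg _ (hh f hf)

/-- The prime divisor moved by a horizontal root subgroup is stable under `SL₂ × T'`: the derivation
of the root subgroup commutes with `F.up`, so that its valuation is invariant under the shift by
the degree of `F.up`, and hence under the opposite shift too. -/
theorem IsGenerator.stable_faceIdeal (h : F.IsGenerator σ D e c d)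
    (hh : ¬ ∀ f, F.up f = 0 → D f = 0) :
    ∀ g, ∀ f ∈ F.B.faceIdeal h.hom.root, θ g f ∈ F.B.faceIdeal h.hom.root := by
  have hmon : ∀ f ∈ F.B.faceIdeal h.hom.root, ∀ m, F.B.coef f m ≠ 0 →
      F.B.mon m ∈ F.B.faceIdeal h.hom.root := by
    intro f hf m hm
    rw [F.B.mon_mem_faceIdeal _ (F.B.mem_of_coef_ne_zero hm)]
    exact Nat.pos_of_ne_zero fun h0 => hm ((F.B.mem_faceIdeal _).1 hf m h0)
  have hshift : F.up ≠ 0 → ∀ m ∈ F.B.S, m + (2, 0) ∈ F.B.S → d (m + (2, 0)) = d m := by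
    intro hup
    obtain ⟨m₀, hm₀, hp₀, hd₀⟩ := h.exists_of_horizontal hh
    rw [Ne, F.hom_up.eq_zero_iff] at hup
    push Not at hup
    obtain ⟨m₁, hm₁, hp₁⟩ := hup
    exact (h.hom.shift_eq_of_commute F.hom_up h.commute hm₀ hp₀ hd₀ hm₁
      (Nat.pos_of_ne_zero hp₁)).1
  rw [F.stable_iff]
  refine ⟨fun t f hf => ?_, F.hom_up.stable_of_mon hmon fun m hm hmP hp => ?_,
    F.hom_low.stable_of_mon hmon fun m hm hmP hp => ?_⟩
  · rw [F.B.mem_faceIdeal] at hf ⊢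
    intro m hm
    rw [F.torus.coef_apply, hf m hm, mul_zero]
  · have hS := (F.hom_up.root.shift m hm hp).1
    rw [F.B.mon_mem_faceIdeal _ hm] at hmP
    rw [F.B.mon_mem_faceIdeal _ hS, hshift (fun h0 => ?_) m hm hS]
    · exact hmP
    · exact hp.ne' (F.hom_up.eq_zero_iff.1 h0 m hm)
  · have hS := (F.hom_low.root.shift m hm hp).1
    rw [F.B.mon_mem_faceIdeal _ hm] at hmP
    have hadd : m + -(2, 0) + (2, 0) = m := neg_add_cancel_right _ _
    have h1 := hshift (fun h0 => ?_) _ hS (hadd.symm ▸ hm)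
    · rw [hadd] at h1
      rwa [F.B.mon_mem_faceIdeal _ hS, ← h1]
    · exact hp.ne' (F.hom_low.eq_zero_iff.1 (F.up_eq_zero_iff.1 h0) m hm)

variable [IsDomain A]

theorem exists_isGenerator (F : Frame θ) {H : Subgroup (A ≃ₐ[K] A)} (hH : IsGaSubgroup H)
    (hn : ∀ b ∈ stdBorel K n, ∀ h ∈ H, θ b * h * (θ b)⁻¹ ∈ H) :
    ∃ σ D e c d, F.IsGenerator σ D e c d ∧ H = σ.range := by
  obtain ⟨σ, hσ, hσ1, rfl⟩ := hH
  obtain ⟨D, hD⟩ := exists_isFlow hσ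
  have hD0 : D ≠ 0 := fun h => hσ1 (hD.eq_one_iff.2 h)
  have hex : ∀ b ∈ stdBorel K n, ∃ r : K, ∀ f, θ b (D f) = r • D (θ b f) := by
    intro b hb
    obtain ⟨r, hr⟩ := hn b hb (σ (Multiplicative.ofAdd 1)) ⟨_, rfl⟩
    refine ⟨r.toAdd, hD.conj_derivation hD _ _ fun f => ?_⟩
    rw [ofAdd_toAdd, hr, AlgEquiv.mul_apply, AlgEquiv.mul_apply, ← AlgEquiv.mul_apply (θ b)⁻¹,
      inv_mul_cancel, AlgEquiv.one_apply]
  choose r hr using fun t => hex _ (diagHom_mem_stdBorel (n := n) t)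
  obtain ⟨e, he⟩ := F.torus.exists_degree hD0 hr
  obtain ⟨c, d, hd⟩ := F.torus.exists_isHomogeneous hD.exists_iterate_eq_zero
    (fun t f => (he t) ▸ hr t f)
  refine ⟨σ, D, e, c, d, ⟨hD, hD0, hd, (F.flow_up.commute_iff D).1 fun s f => ?_⟩, rfl⟩
  obtain ⟨l, hl⟩ := hex _ (upHom_mem_stdBorel (n := n) s)
  have h1 : l = 1 := hd.scale_eq_one hD0 F.hom_up F.flow_up (fun k hk h => hk ?_) hl
  · rw [h1] at hl
    exact ((hl f).trans (one_smul _ _)).symm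
  · simpa using congrArg Prod.fst h

theorem IsGenerator.normalized (h : F.IsGenerator σ D e c d) {b : G K n} (hb : b ∈ stdBorel K n)
    {φ : A ≃ₐ[K] A} (hφ : φ ∈ σ.range) : θ b * φ * (θ b)⁻¹ ∈ σ.range := by
  have hD : ∃ r : K, ∀ f, θ b (D f) = r • D (θ b f) := by
    obtain ⟨t, s, rfl⟩ := exists_eq_diagHom_mul_upHom hb
    refine ⟨torusChar K e t, fun f => ?_⟩
    rw [map_mul, AlgEquiv.mul_apply, AlgEquiv.mul_apply]
    have h1 := (F.flow_up.commute_iff D).2 h.commute s f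
    rw [MonoidHom.comp_apply] at h1
    rw [← h1]
    generalize θ (upHom K n s) f = g
    apply F.B.coef_injective
    ext m
    obtain ⟨m, rfl⟩ : ∃ m', m = m' + e := ⟨m - e, by abel⟩
    change F.B.coef (θ.comp (diagHom K n) t (D g)) _ =
      F.B.coef (_ • D (θ.comp (diagHom K n) t g)) _
    rw [F.torus.coef_apply, map_smul, Finsupp.smul_apply, h.hom.coef_apply, h.hom.coef_apply,
      F.torus.coef_apply, F.torus.map_add, MonoidHom.mul_apply, smul_eq_mul]
    ring
  obtain ⟨s, rfl⟩ := hφ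
  obtain ⟨r, hr⟩ := hD
  refine ⟨Multiplicative.ofAdd (r * s.toAdd), ?_⟩
  rw [eq_mul_inv_iff_mul_eq]
  ext f
  exact (h.flow.conj h.flow (θ b) r hr s.toAdd f).symm

theorem IsGenerator.isGaSubgroup (h : F.IsGenerator σ D e c d) : IsGaSubgroup σ.range :=
  ⟨σ, fun f => let ⟨p, _, hp⟩ := h.flow f; ⟨p, hp⟩, fun h1 => h.ne_zero (h.flow.eq_one_iff.1 h1),
    rfl⟩

theorem IsGenerator.height_faceIdeal [IsNoetherianRing A] (h : F.IsGenerator σ D e c d) :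
    (F.B.faceIdeal h.hom.root).height = 1 :=
  let ⟨_, hm, hd⟩ := h.exists_pos
  F.B.height_faceIdeal h.hom.root hm hd

/-- The face ideal is the only torus stable prime ideal of height one that is moved. -/
theorem IsGenerator.not_stable_iff [IsNoetherianRing A] (h : F.IsGenerator σ D e c d) {Q : Ideal A}
    [Q.IsPrime] (hQ : Q.height = 1) (hQt : ∀ t, ∀ f ∈ Q, θ.comp (diagHom K n) t f ∈ Q) :
    (¬ ∀ f ∈ Q, D f ∈ Q) ↔ F.B.faceIdeal h.hom.root = Q := by
  constructor
  · intro hs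
    obtain ⟨m, hm, hmQ, hd, hme⟩ :
        ∃ m ∈ F.B.S, F.B.mon m ∈ Q ∧ 0 < d m ∧ F.B.mon (m + e) ∉ Q := by
      by_contra! h1
      exact hs (h.hom.stable_of_mon (fun f hf m hm => F.torus.mon_mem hQt hf hm) h1)
    refine eq_of_le_of_height_eq_one hQ ?_ (F.B.faceIdeal_le h.hom.root hm hd hmQ hme)
    exact fun h0 => F.B.mon_ne_zero hm
      ((Submodule.mem_bot A).1 (h0 ▸ (F.B.mon_mem_faceIdeal h.hom.root hm).2 hd))
  · rintro rfl
    exact h.hom.not_stable_faceIdeal h.ne_zero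

/-- A vertical root subgroup does not move prime divisors stable under `SL₂ × T'`: its face ideal is
that of `F.up`, which `F.up` moves. -/
theorem IsGenerator.horizontal_of_stable [IsNoetherianRing A] (h : F.IsGenerator σ D e c d)
    (hs : ∀ g, ∀ f ∈ F.B.faceIdeal h.hom.root, θ g f ∈ F.B.faceIdeal h.hom.root) :
    ¬ ∀ f, F.up f = 0 → D f = 0 := by
  intro hv
  have hle : F.B.faceIdeal h.hom.root ≤ F.B.faceIdeal F.hom_up.root := by
    intro f hf
    rw [F.B.mem_faceIdeal] at hf ⊢
    intro m hm
    by_contra hfm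
    have hmS := F.B.mem_of_coef_ne_zero hfm
    exact hfm (hf m ((h.hom.apply_mon_eq_zero_iff hmS).1
      (hv _ ((F.hom_up.apply_mon_eq_zero_iff hmS).2 hm))))
  obtain ⟨m, hm, hd⟩ := h.exists_pos
  have hpos : 0 < F.dUp m := (F.B.mon_mem_faceIdeal F.hom_up.root hm).1
    (hle ((F.B.mon_mem_faceIdeal h.hom.root hm).2 hd))
  have heq := eq_of_le_of_height_eq_one (F.B.height_faceIdeal F.hom_up.root hm hpos)
    (fun h0 => F.B.mon_ne_zero hm
      ((Submodule.mem_bot A).1 (h0 ▸ (F.B.mon_mem_faceIdeal h.hom.root hm).2 hd))) hle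
  refine F.hom_up.not_stable_faceIdeal (fun h0 => hpos.ne' (F.hom_up.eq_zero_iff.1 h0 m hm)) ?_
  rw [← heq]
  exact ((F.stable_iff _).1 hs).2.1

/-- Every prime ideal of height one stable under `SL₂ × T'` is the face ideal of a generator. -/
theorem exists_isGenerator_faceIdeal_eq [IsNoetherianRing A] [IsIntegrallyClosed A] (F : Frame θ)
    {Q : Ideal A} [Q.IsPrime] (hQ : Q.height = 1) (hs : ∀ g, ∀ f ∈ Q, θ g f ∈ Q) :
    ∃ σ D e c d, ∃ h : F.IsGenerator σ D e c d, F.B.faceIdeal h.hom.root = Q := by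
  obtain ⟨ht, hu, hl⟩ := (F.stable_iff Q).1 hs
  have hmon : ∀ f ∈ Q, ∀ m, F.B.coef f m ≠ 0 → F.B.mon m ∈ Q :=
    fun f hf m hm => F.torus.mon_mem ht hf hm
  obtain ⟨e, d, hr, hd, hcomm⟩ : ∃ e d, ∃ hr : IsRoot F.B.S e d,
      (∀ m ∈ F.B.S, 0 < d m ↔ F.B.mon m ∈ Q) ∧
        ∀ f, F.B.rootDerivation hr (F.up f) = F.up (F.B.rootDerivation hr f) := by
    by_cases hup : F.up = 0
    · obtain ⟨e, d, hr, hd⟩ := F.B.exists_isRoot Q hQ hmon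
      exact ⟨e, d, hr, hd, fun f => by simp [hup]⟩
    · obtain ⟨e, d, hr, hd, h1, h2⟩ := F.B.exists_isRoot_shift_eq Q hQ hmon F.hom_up F.hom_low hup
        (fun h0 => hup (F.up_eq_zero_iff.2 h0)) hu hl
      exact ⟨e, d, hr, hd, (F.B.isHomogeneous_rootDerivation hr).commute_of_shift_eq F.hom_up h1 h2⟩
  have hhom := F.B.isHomogeneous_rootDerivation hr
  have hface : F.B.faceIdeal hr = Q := by
    ext f
    constructor
    · intro hf
      refine F.B.mem_of_forall_mon_mem fun m hm => ?_
      exact (hd m (F.B.mem_of_coef_ne_zero hm)).1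
        (Nat.pos_of_ne_zero fun h0 => hm ((F.B.mem_faceIdeal hr).1 hf m h0))
    · intro hf
      rw [F.B.mem_faceIdeal]
      intro m hm
      by_contra h0
      exact ((hd m (F.B.mem_of_coef_ne_zero h0)).2 (hmon f hf m h0)).ne' hm
  have hne : F.B.rootDerivation hr ≠ 0 := by
    rw [Ne, hhom.eq_zero_iff]
    intro h0
    have hbot : Q = ⊥ := by
      rw [← hface, eq_bot_iff]
      intro f hf
      refine F.B.mem_of_forall_mon_mem fun m hm => absurd ((F.B.mem_faceIdeal hr).1 hf m ?_) hm
      exact h0 m (F.B.mem_of_coef_ne_zero hm)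
    rw [hbot, Ideal.height_bot] at hQ
    exact zero_ne_one hQ
  obtain ⟨σ, hσ⟩ := exists_flow_of_locallyNilpotent hhom.exists_iterate_eq_zero
  exact ⟨σ, _, e, 1, d, ⟨hσ, hne, hhom, hcomm⟩, hface⟩

end Generators

section Equivalence

variable {K A : Type*} [Field K] [CharZero K] [IsAlgClosed K] [CommRing A] [IsDomain A]
  [Algebra K A] [Algebra.FiniteType K A] {n : ℕ}
  {θ : G K n →* (A ≃ₐ[K] A)} {F : Frame θ} {σ τ : Multiplicative K →* (A ≃ₐ[K] A)}
  {D E : Derivation K A A} {e e' : ℤ × (Fin n → ℤ)} {c c' : K} {d d' : ℤ × (Fin n → ℤ) → ℕ}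

/-- Two root subgroups are equivalent if and only if they have the same face: the face determines
the valuation `d`, so that the two derivations become proportional after multiplication by invariant
monomials. Conversely, equivalent actions have the same invariants. -/
theorem IsGenerator.equivalent_iff (h : F.IsGenerator σ D e c d) (h' : F.IsGenerator τ E e' c' d') :
    Equivalent σ.range τ.range ↔ F.B.faceIdeal h.hom.root = F.B.faceIdeal h'.hom.root := by
  constructor
  · intro heq
    have hd : ∀ m ∈ F.B.S, d m = 0 ↔ d' m = 0 := by
      intro m hm
      rw [← h.hom.apply_mon_eq_zero_iff hm, ← h'.hom.apply_mon_eq_zero_iff hm]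
      exact ⟨h.flow.eq_zero_of_equivalent h'.flow heq,
        h'.flow.eq_zero_of_equivalent h.flow (equivalent_equivalence.symm heq)⟩
    ext f
    rw [F.B.mem_faceIdeal, F.B.mem_faceIdeal]
    refine forall_congr' fun m => ?_
    by_cases hm : F.B.coef f m = 0
    · simp [hm]
    · rw [hd m (F.B.mem_of_coef_ne_zero hm)]
  · intro heq
    have hd : ∀ m ∈ F.B.S, d m = d' m := by
      refine fun m hm => h.hom.root.eq_of_face_eq h'.hom.root (fun m hm => ?_) hm
      rw [← not_iff_not, ← ne_eq, ← ne_eq, ← Nat.pos_iff_ne_zero, ← Nat.pos_iff_ne_zero,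
        ← F.B.mon_mem_faceIdeal h.hom.root hm, ← F.B.mon_mem_faceIdeal h'.hom.root hm, heq]
    obtain ⟨m₀, hm₀, hd₀⟩ := h.exists_pos
    obtain ⟨m, hm, hm1⟩ := h.hom.root.exists_eq_one hm₀ hd₀
    have hm1' := (hd m hm).symm.trans hm1
    obtain ⟨hS, hd1⟩ := h.hom.root.shift m hm (by omega)
    obtain ⟨hS', hd1'⟩ := h'.hom.root.shift m hm (by omega)
    have hz : ∀ {m}, m ∈ F.B.S → d m = 0 → ∀ k : K,
        D (k • F.B.mon m) = 0 ∧ E (k • F.B.mon m) = 0 := by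
      intro m hm h0 k
      rw [D.map_smul, E.map_smul, (h.hom.apply_mon_eq_zero_iff hm).2 h0,
        (h'.hom.apply_mon_eq_zero_iff hm).2 ((hd m hm).symm.trans h0), smul_zero]
      exact ⟨rfl, rfl⟩
    obtain ⟨h1, h2⟩ := hz hS (by omega) c
    obtain ⟨h3, h4⟩ := hz hS' (by rw [hd _ hS']; omega) c'
    refine h.flow.equivalent_of_mul_eq h'.flow (a := c • F.B.mon (m + e))
      (b := c' • F.B.mon (m + e')) (smul_ne_zero h.hom.ne_zero (F.B.mon_ne_zero hS))
      (smul_ne_zero h'.hom.ne_zero (F.B.mon_ne_zero hS')) h1 h3 h2 h4 fun f => ?_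
    induction f using F.B.induction with
    | mon p hp =>
      rw [h.hom.apply_mon p hp, h'.hom.apply_mon p hp, ← hd p hp]
      rcases Nat.eq_zero_or_pos (d p) with h0 | h0
      · simp [h0]
      · rw [smul_mul_smul_comm, smul_mul_smul_comm,
          ← F.B.mon_add hS' (h.hom.root.shift p hp h0).1,
          ← F.B.mon_add hS (h'.hom.root.shift p hp (hd p hp ▸ h0)).1]
        congr 1
        · ring
        · congr 1
          abel
    | zero => simp
    | add f g hf hg => rw [map_add, map_add, mul_add, mul_add, hf, hg]
    | smul k f hf => rw [D.map_smul, E.map_smul, mul_smul_comm, mul_smul_comm, hf]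

end Equivalence

end Frame

/-! ### Horizontal root subgroups and stable prime divisors -/

section Reformulation

variable {K A : Type*} [Field K] [CommRing A] [Algebra K A] {n : ℕ}
  {ρ : G K n →* (A ≃ₐ[K] A)} {γ : G K n}

theorem isBRootSubgroup_iff {H : Subgroup (A ≃ₐ[K] A)} :
    IsBRootSubgroup ρ γ H ↔ IsGaSubgroup H ∧ ∀ b ∈ stdBorel K n, ∀ h ∈ H,
      ρ.comp (MulAut.conj γ).toMonoidHom b * h * (ρ.comp (MulAut.conj γ).toMonoidHom b)⁻¹ ∈ H := by
  refine and_congr_right fun _ => ⟨fun h b hb => h _ ⟨b, hb, rfl⟩, ?_⟩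
  rintro h _ ⟨b, hb, rfl⟩
  exact h b hb

theorem range_comp_conj :
    (ρ.comp (MulAut.conj γ).toMonoidHom).range = ρ.range :=
  (MonoidHom.range_comp _ _).trans (by
    rw [MonoidHom.range_eq_top.2 (MulAut.conj γ).surjective, ← MonoidHom.range_eq_map])

theorem isStable_range_iff (Y : PrimeDivisor K A) :
    IsStable ρ.range (Y.1 : Set (Pt K A)) ↔ ∀ g, ∀ f ∈ vanishing (Y.1 : Set (Pt K A)),
      ρ.comp (MulAut.conj γ).toMonoidHom g f ∈ vanishing (Y.1 : Set (Pt K A)) := by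
  rw [isStable_iff_vanishing Y.1.isClosed, ← range_comp_conj (γ := γ)]
  simp only [MonoidHom.mem_range, forall_exists_index, forall_apply_eq_imp_iff]

end Reformulation

section Classification

variable {K A : Type*} [Field K] [CharZero K] [CommRing A] [Algebra K A] {n : ℕ}
  {ρ : G K n →* (A ≃ₐ[K] A)} {γ : G K n} {σ : Multiplicative K →* (A ≃ₐ[K] A)}
  {D : Derivation K A A}

theorem moves_iff (hσ : IsFlow σ D) (Y : PrimeDivisor K A) :
    Moves σ.range Y ↔
      ¬ ∀ f ∈ vanishing (Y.1 : Set (Pt K A)), D f ∈ vanishing (Y.1 : Set (Pt K A)) := by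
  rw [Moves, isStable_iff_vanishing Y.1.isClosed, ← hσ.stable_iff]
  simp only [MonoidHom.mem_range, forall_exists_index, forall_apply_eq_imp_iff]

variable [IsDomain A]

theorem isVertical_iff (F : Frame (ρ.comp (MulAut.conj γ).toMonoidHom)) (hσ : IsFlow σ D) :
    IsVertical ρ γ σ.range ↔ ∀ f, F.up f = 0 → D f = 0 := by
  refine forall_congr' fun f => ?_
  rw [← F.flow_up.invariant_iff, ← hσ.invariant_iff, unipotent, stdUnipotent_eq_range]
  simp only [Subgroup.mem_map, MonoidHom.mem_range, forall_exists_index, and_imp,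
    forall_apply_eq_imp_iff]
  rfl

variable [IsAlgClosed K] [Algebra.FiniteType K A]

theorem moves_iff_faceIdeal_eq {F : Frame (ρ.comp (MulAut.conj γ).toMonoidHom)}
    {e : ℤ × (Fin n → ℤ)} {c : K} {d : ℤ × (Fin n → ℤ) → ℕ} (h : F.IsGenerator σ D e c d)
    (Y : GStablePrimeDivisor ρ) :
    Moves σ.range Y.1 ↔ F.B.faceIdeal h.hom.root = vanishing (Y.1.1 : Set (Pt K A)) := by
  have : IsNoetherianRing A := Algebra.FiniteType.isNoetherianRing K A
  rw [moves_iff h.flow, h.not_stable_iff (PrimeDivisor.height_eq_one _)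
    (fun t => (isStable_range_iff (γ := γ) Y.1).1 Y.2 _)]

theorem exists_moves_of_horizontal (F : Frame (ρ.comp (MulAut.conj γ).toMonoidHom))
    {H : Subgroup (A ≃ₐ[K] A)} (hB : IsBRootSubgroup ρ γ H) (hH : ¬ IsVertical ρ γ H) :
    ∃ Y : GStablePrimeDivisor ρ, Moves H Y.1 := by
  have : IsNoetherianRing A := Algebra.FiniteType.isNoetherianRing K A
  obtain ⟨h1, h2⟩ := isBRootSubgroup_iff.1 hB
  obtain ⟨σ, D, e, c, d, h, rfl⟩ := F.exists_isGenerator h1 h2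
  rw [isVertical_iff F h.flow] at hH
  obtain ⟨Y, hY⟩ := PrimeDivisor.exists_vanishing_eq (K := K)
    (F.B.isPrime_faceIdeal h.hom.root) h.height_faceIdeal
  have hs := h.stable_faceIdeal hH
  rw [← hY, ← isStable_range_iff] at hs
  exact ⟨⟨Y, hs⟩, (moves_iff_faceIdeal_eq h _).2 hY.symm⟩

theorem not_isVertical_of_moves (F : Frame (ρ.comp (MulAut.conj γ).toMonoidHom))
    {H : Subgroup (A ≃ₐ[K] A)} (hB : IsBRootSubgroup ρ γ H) {Y : GStablePrimeDivisor ρ}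
    (hY : Moves H Y.1) : ¬ IsVertical ρ γ H := by
  have : IsNoetherianRing A := Algebra.FiniteType.isNoetherianRing K A
  obtain ⟨h1, h2⟩ := isBRootSubgroup_iff.1 hB
  obtain ⟨σ, D, e, c, d, h, rfl⟩ := F.exists_isGenerator h1 h2
  rw [isVertical_iff F h.flow]
  apply h.horizontal_of_stable
  rw [(moves_iff_faceIdeal_eq h Y).1 hY]
  exact (isStable_range_iff Y.1).1 Y.2

theorem equivalent_iff_of_moves (F : Frame (ρ.comp (MulAut.conj γ).toMonoidHom))
    {H₁ H₂ : Subgroup (A ≃ₐ[K] A)} (hB₁ : IsBRootSubgroup ρ γ H₁) (hB₂ : IsBRootSubgroup ρ γ H₂)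
    {Y₁ Y₂ : GStablePrimeDivisor ρ} (hY₁ : Moves H₁ Y₁.1) (hY₂ : Moves H₂ Y₂.1) :
    Equivalent H₁ H₂ ↔ Y₁ = Y₂ := by
  obtain ⟨h1, h2⟩ := isBRootSubgroup_iff.1 hB₁
  obtain ⟨σ, D, e, c, d, h, rfl⟩ := F.exists_isGenerator h1 h2
  obtain ⟨h3, h4⟩ := isBRootSubgroup_iff.1 hB₂
  obtain ⟨τ, E, e', c', d', h', rfl⟩ := F.exists_isGenerator h3 h4
  rw [h.equivalent_iff h', (moves_iff_faceIdeal_eq h Y₁).1 hY₁,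
    (moves_iff_faceIdeal_eq h' Y₂).1 hY₂]
  exact ⟨fun heq => Subtype.ext (PrimeDivisor.ext_vanishing heq), fun heq => by rw [heq]⟩

theorem exists_isBRootSubgroup_moves [IsIntegrallyClosed A]
    (F : Frame (ρ.comp (MulAut.conj γ).toMonoidHom)) (Y : GStablePrimeDivisor ρ) :
    ∃ H, IsBRootSubgroup ρ γ H ∧ Moves H Y.1 := by
  have : IsNoetherianRing A := Algebra.FiniteType.isNoetherianRing K A
  obtain ⟨σ, D, e, c, d, h, hQ⟩ := F.exists_isGenerator_faceIdeal_eq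
    (PrimeDivisor.height_eq_one Y.1) ((isStable_range_iff Y.1).1 Y.2)
  exact ⟨σ.range, isBRootSubgroup_iff.2 ⟨h.isGaSubgroup, fun b hb φ hφ => h.normalized hb hφ⟩,
    (moves_iff_faceIdeal_eq h Y).2 hQ⟩

end Classification

end AffineVar

end

theorem mainTheorem4 {K A : Type*} [Field K] [IsAlgClosed K] [CharZero K]
    -- a normal irreducible affine variety `X` with coordinate algebra `A`
    [CommRing A] [IsDomain A] [IsIntegrallyClosed A] [Algebra K A] [Algebra.FiniteType K A]
    -- a regular action of `G = SL₂ × T'` on `X`, and a pair `T ⊂ B` of subgroups of `G`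
    {n : ℕ} (ρ : AffineVar.G K n →* (A ≃ₐ[K] A)) (hρ : AffineVar.IsRegularAction ρ)
    (γ : AffineVar.G K n)
    -- `X` is toric as a `T`-variety
    (hT : AffineVar.HasOpenOrbit ρ (AffineVar.torus γ)) :
    ∃ Φ : Quotient (AffineVar.horizontalSetoid ρ γ) ≃ AffineVar.GStablePrimeDivisor ρ,
      ∀ (D : AffineVar.GStablePrimeDivisor ρ) (H : Subgroup (A ≃ₐ[K] A))
        (hB : AffineVar.IsBRootSubgroup ρ γ H),
        AffineVar.Moves H D.1 ↔
          ∃ hH : ¬ AffineVar.IsVertical ρ γ H,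
            Φ (Quotient.mk (AffineVar.horizontalSetoid ρ γ) ⟨H, hB, hH⟩) = D := by
  obtain ⟨x, hx⟩ := hT.exists_dense
  obtain ⟨F⟩ := AffineVar.exists_frame (hρ.comp_conj γ) x hx
  choose φ hφ using fun H : AffineVar.HorizontalBRootSubgroup ρ γ =>
    AffineVar.exists_moves_of_horizontal F H.2.1 H.2.2
  have hiff : ∀ H₁ H₂, AffineVar.Equivalent H₁.1 H₂.1 ↔ φ H₁ = φ H₂ := fun H₁ H₂ =>
    AffineVar.equivalent_iff_of_moves F H₁.2.1 H₂.2.1 (hφ H₁) (hφ H₂)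
  have hunique : ∀ (H : AffineVar.HorizontalBRootSubgroup ρ γ)
      (D : AffineVar.GStablePrimeDivisor ρ),
      AffineVar.Moves H.1 D.1 ↔ φ H = D := fun H D =>
    ⟨fun h => (AffineVar.equivalent_iff_of_moves F H.2.1 H.2.1 (hφ H) h).1
      (AffineVar.equivalent_equivalence.refl _), fun h => h ▸ hφ H⟩
  refine ⟨Equiv.ofBijective (Quotient.lift φ fun H₁ H₂ h => (hiff H₁ H₂).1 h) ⟨?_, fun D => ?_⟩,
    fun D H hB => ⟨fun h => ?_, ?_⟩⟩
  · rintro ⟨H₁⟩ ⟨H₂⟩ h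
    exact Quotient.sound ((hiff H₁ H₂).2 h)
  · obtain ⟨H, hB, hH⟩ := AffineVar.exists_isBRootSubgroup_moves F D
    exact ⟨Quotient.mk _ ⟨H, hB, AffineVar.not_isVertical_of_moves F hB hH⟩, (hunique _ _).1 hH⟩
  · have hH := AffineVar.not_isVertical_of_moves F hB h
    exact ⟨hH, (hunique ⟨H, hB, hH⟩ D).1 h⟩
  · rintro ⟨hH, h⟩
    exact (hunique ⟨H, hB, hH⟩ D).2 h
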